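/- **Setting.** Let $T\ge T_0$ ($T_0\ge 1$) denote the sample size and $p=p_T$ the number of regressors. For each $T$ let $x_t=(x_{t1},\dots,x_{tp})^\top$, $t\ge 1$, be regressors (allowed to depend on $T$, and possibly random; working conditionally on the regressors is the case of non-random $x_t$), and let $\mathbb X_T=(x_1,\dots,x_T)^\top$. For fixed $\nu$ and an arbitrary $\beta_\nu\in\mathbb R^{p}$ let $Y_t^{(\nu)}=x_t^\top\beta_\nu+\epsilon_t^{(\nu)}$, and let $\hat\beta_{T\nu}=(\mathbb X_T^\top\mathbb X_T)^{-1}\mathbb X_T^\top (Y^{(\nu)}_1,\dots,Y^{(\nu)}_T)^\top$ be the least squares estimator. **Assumption (R).** Almost surely, the regressors are bounded by a constant, and there are positive definite $p\times p$ matrices $\Sigma_x$, constants $\eta\ge 0$, $C<\infty$ and a compact interval $A\subset(0,\infty)$ such that for all $T\ge T_0$ $$\Big\|\tfrac1T\sum_{t=1}^T x_tx_t^\top-\Sigma_x\Big\|_2\le C\,\frac{p^\eta}{\sqrt T},\qquad \operatorname{spec}(T^{-1}\mathbb X_T^\top\mathbb X_T)\subset A .$$ **Assumption (G), growth of sum moment,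 with constants $\gamma'\ge2$, $C_\nu$.** For all $2\le\gamma\le\gamma'$ and all $N\in\mathbb N$, $\ \sup_j \mathbb E\big|\sum_{t=1}^N x_{tj}\epsilon_t^{(\nu)}\big|^\gamma\le C_\nu N^{\gamma/2}$. **Rate condition.** $p\le T$ for $T\ge T_0$ and $p=o(T)$ if $0\le\eta\le 1/2$; $p^{2\eta}=o(T)$ if $\eta>1/2$. **Theorem.** Suppose (R) holds. (i) If the rate condition holds and $\gamma'\ge 2$, there are constants $K,C'>0$, depending only on the design and $\gamma'$, such that for all errors $\epsilon^{(\nu)}$ that satisfy (G) with $\gamma'$ and $C_\nu$, all $2\le\gamma\le\gamma'$, all $\delta>0$ and all $T\ge T_0$ $$\mathbb P(\|\hat\beta_{T\nu}-\beta_\nu\|_2>\delta)\le K C_\nu\Big(\sqrt{p/T}\Big)^{\gamma}\delta^{-\gamma},$$ in particular $\hat\beta_{T\nu}=\beta_\nu+O_{\mathbb P}(\sqrt{p/T})$, and $$\mathbb E\|\hat\beta_{T\nu}-\beta_\nu\|_2^2\le\Big(C'\frac{p^\eta}{\sqrt T}+\lambda_{\min}^{-1}\Big)^2 C_\nu\,\frac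 pT ,$$ where $\lambda_{\min}=\inf_{T\ge T_0}\inf\operatorname{spec}(T^{-1}\mathbb X_T^\top\mathbb X_T)$ (essential infimum for random regressors), and this upper bound is $o(1)$ as $T\to\infty$. (ii) Let the errors follow the spatial factor/linear-process model $$\epsilon_t^{(\nu)}=H_\nu(U_t,\dots,U_{t-m})-\mathbb E H_\nu(U_t,\dots,U_{t-m}),\quad U_t^{(\nu)}(s)=\sum_{\ell=1}^L\phi_{\nu\ell}\,d(s,r_\ell)F_t^{(\ell,\nu)}+F_t^{(0,\nu)},\quad F_t^{(\ell)}=\sum_{j\ge0}\mathbb C_j^{(\ell)}\varepsilon_{t-j}^{(\ell)},$$ $1\le\nu\le d$, the $U$'s being evaluated at locations in $[0,1]^q$ along the path of the object, where $r_1,\dots,r_L\in[0,1]^q$, $d(u,v)\in[0,1]$ is a nonincreasing function of $\|u-v\|$ (for some norm) with $d(u,u)=1$, and for $\ell=0,\dots,L$, $t\in\mathbb Z$: (a) the innovations $\varepsilon_t^{(\ell)}=(\Sigma_t^{(\ell)})^{1/2}u_t^{(\ell)}$ are independent over $(\ell,t)$, with symmetric positive definite $\Sigma_t^{(\ell)}$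 and mean zero $u_t^{(\ell)}$ with independent coordinates; (b) their coordinates have uniformly bounded fourth moments; (c) $\lambda_{\min}(\Sigma_t^{(0)})$ (for $d=1$: the variance of $\varepsilon^{(0)}_t$) is bounded away from $0$ uniformly in $t$; (d) the coordinates have densities $p_t^{(\ell,\nu)}$ with $\sup_{t\ge1}\int|p_t^{(\ell,\nu)}(z+x)-p_t^{(\ell,\nu)}(z)|\,dz=O(|x|)$; (e) the entries of $\mathbb C_j^{(\ell)}$ are bounded by $\mathrm{const}\cdot\max(j,1)^{-5-\delta'}$ for some $\delta'>0$; (f) the $H_\nu:\mathbb R^{d\times(m+1)}\to\mathbb R$ are Lipschitz continuous in the Frobenius norm, and $\mathbb E|H_\nu(\Xi)|^4<\infty$ for some random matrix $\Xi$ independent of $\{U_t\}$. If the regressors are non-random, or random and independent of the innovations, then (G) holds with $\gamma'=2$ and some $C_\nu$; hence, under the rate condition, the assertions of (i) hold with $\gamma'=2$. (iii) Let the regressors be the output $x_t=x_t^{(r)}$ of the last hidden layer of an extreme learning machine with $r\ge1$ hidden layers ($r=1$: single hidden layer), $$x_{tj}^{(k)}=g_k\big(b_{jk}+w_j^{(k)\top}x_t^{(k-1)}\big),\quad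 1\le j\le n_k,\ 1\le k\le r,\qquad x_t^{(0)}=z_t,\quad n_r=p,$$ with measurable activations, where the random weights and biases together with the (random or fixed) inputs $z_t$ are independent of the innovations; activations may differ between neurons and widths may depend on $T$. If the errors are as in (ii), then (G) holds with $\gamma'=2$ and some $C_\nu$, and hence, under the rate condition, the assertions of (i) hold with $\gamma'=2$, both with respect to the joint probability and, almost surely and with the same constants, conditionally on the weights and inputs. -/

import Mathlib

open MeasureTheory ProbabilityTheory Filter Topology

noncomputable section

/-! ## Regressors and least squares

The regressors form an array `X T t j`: `T` is the sample size, `t ≥ 1` the time point and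
`j < p T` the coordinate of the regressor vector. They are random variables on the same space as the
errors; working conditionally on `X_t = x_t` means that `X` does not depend on `ω`. -/

/-- The `T × p` design matrix, whose rows are the regressor vectors at times `1, …, T`. -/
def designMatrix {Ω : Type*} (p : ℕ → ℕ) (X : ℕ → ℕ → ℕ → Ω → ℝ) (T : ℕ) (ω : Ω) :
    Matrix (Fin T) (Fin (p T)) ℝ :=
  Matrix.of fun t j => X T (t + 1) j ω

/-- The Gram matrix `T⁻¹ 𝕏ᵀ 𝕏 = T⁻¹ ∑ₜ xₜ xₜᵀ`. -/
def gramMatrix {Ω : Type*} (p : ℕ → ℕ) (X : ℕ → ℕ → ℕ → Ω → ℝ) (T : ℕ) (ω : Ω) :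
    Matrix (Fin (p T)) (Fin (p T)) ℝ :=
  (T : ℝ)⁻¹ • ((designMatrix p X T ω).transpose * designMatrix p X T ω)

/-- The responses `Y_t = x_tᵀ β + e_t`, `t = 1, …, T`. -/
def response {Ω : Type*} (p : ℕ → ℕ) (X : ℕ → ℕ → ℕ → Ω → ℝ) (e : ℕ → Ω → ℝ)
    (β : ∀ T, Fin (p T) → ℝ) (T : ℕ) (ω : Ω) : Fin T → ℝ :=
  fun t => (designMatrix p X T ω).mulVec (β T) t + e (t + 1) ω

/-- The least squares estimator `(𝕏ᵀ 𝕏)⁻¹ 𝕏ᵀ Y`. -/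
def leastSquares {Ω : Type*} (p : ℕ → ℕ) (X : ℕ → ℕ → ℕ → Ω → ℝ) (e : ℕ → Ω → ℝ)
    (β : ∀ T, Fin (p T) → ℝ) (T : ℕ) (ω : Ω) : Fin (p T) → ℝ :=
  (((designMatrix p X T ω).transpose * designMatrix p X T ω)⁻¹ *
    (designMatrix p X T ω).transpose).mulVec (response p X e β T ω)

/-- The Euclidean norm of the estimation error of least squares. -/
def estError {Ω : Type*} (p : ℕ → ℕ) (X : ℕ → ℕ → ℕ → Ω → ℝ) (e : ℕ → Ω → ℝ)
    (β : ∀ T, Fin (p T) → ℝ) (T : ℕ) (ω : Ω) : ℝ :=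
  ‖WithLp.toLp 2 (leastSquares p X e β T ω - β T)‖

/-- The regressors are bounded by `B`, and for all `T ≥ T₀` the Gram matrix is within
`C p^η / √T` of the positive definite matrix `Sx T` in spectral norm and has its spectrum in the
compact interval `[a, b] ⊂ (0, ∞)`, almost surely. -/
structure RegressorAssumption {Ω : Type*} [MeasurableSpace Ω] (μ : Measure Ω) (T₀ : ℕ)
    (p : ℕ → ℕ) (X : ℕ → ℕ → ℕ → Ω → ℝ) (Sx : ∀ T, Matrix (Fin (p T)) (Fin (p T)) ℝ)
    (B η C a b : ℝ) : Prop where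
  bounded : ∀ T ≥ T₀, ∀ t ≥ 1, ∀ j < p T, ∀ᵐ ω ∂μ, |X T t j ω| ≤ B
  posDef : ∀ T ≥ T₀, (Sx T).PosDef
  eta_nonneg : 0 ≤ η
  a_pos : 0 < a
  a_le_b : a ≤ b
  rate : ∀ T ≥ T₀, ∀ᵐ ω ∂μ,
    ‖Matrix.toEuclideanCLM (𝕜 := ℝ) (gramMatrix p X T ω - Sx T)‖ ≤ C * (p T : ℝ) ^ η / √(T : ℝ)
  spec : ∀ T ≥ T₀, ∀ᵐ ω ∂μ, spectrum ℝ (gramMatrix p X T ω) ⊆ Set.Icc a b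

/-- `T ≥ p` and `p = o(T)` if `η ≤ 1/2`; `p^{2η} = o(T)` if `η > 1/2`. -/
def RateCondition (T₀ : ℕ) (p : ℕ → ℕ) (η : ℝ) : Prop :=
  (η ≤ 1 / 2 → (∀ T ≥ T₀, p T ≤ T) ∧ Tendsto (fun T => (p T : ℝ) / T) atTop (𝓝 0)) ∧
  (1 / 2 < η → Tendsto (fun T => (p T : ℝ) ^ (2 * η) / T) atTop (𝓝 0))

/-- The growth of sum moment assumption
`sup_j E |∑_{t=1}^N x_{tj} e_t|^γ ≤ Cν N^{γ/2}` for all `N` and all `2 ≤ γ ≤ γ'`. -/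
def GrowthOfSumMoment {Ω : Type*} [MeasurableSpace Ω] (μ : Measure Ω) (T₀ : ℕ)
    (p : ℕ → ℕ) (X : ℕ → ℕ → ℕ → Ω → ℝ) (e : ℕ → Ω → ℝ) (γ' Cν : ℝ) : Prop :=
  ∀ γ : ℝ, 2 ≤ γ → γ ≤ γ' → ∀ T ≥ T₀, ∀ N : ℕ, ∀ j < p T,
    Integrable (fun ω => |∑ t ∈ Finset.Icc 1 N, X T t j ω * e t ω| ^ γ) μ ∧
    ∫ ω, |∑ t ∈ Finset.Icc 1 N, X T t j ω * e t ω| ^ γ ∂μ ≤ Cν * (N : ℝ) ^ (γ / 2)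

/-- The infimum of the spectra of all Gram matrices. It is the plain infimum for a non-random design,
and its essential infimum over `ω` for a random one. -/
def lamMin {Ω : Type*} [MeasurableSpace Ω] (μ : Measure Ω) (T₀ : ℕ) (p : ℕ → ℕ)
    (X : ℕ → ℕ → ℕ → Ω → ℝ) : ℝ :=
  essInf (fun ω => sInf {l : ℝ | ∃ T ≥ T₀, l ∈ spectrum ℝ (gramMatrix p X T ω)}) μ

/-- The mean square error bound `(C' p^η / √T + 1 / λ_min)² Cν p / T`. -/
def meanSquareBound {Ω : Type*} [MeasurableSpace Ω] (μ : Measure Ω) (T₀ : ℕ) (p : ℕ → ℕ)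
    (X : ℕ → ℕ → ℕ → Ω → ℝ) (η Cν C' : ℝ) (T : ℕ) : ℝ :=
  (C' * (p T : ℝ) ^ η / √(T : ℝ) + (lamMin μ T₀ p X)⁻¹) ^ 2 * Cν * ((p T : ℝ) / T)

/-- The consistency assertions for least squares, for every true parameter `β`: the tail bound, the
rate `O_P(√(p/T))`, and the mean square bound together with its convergence to `0`. -/
structure ConsistencyAssertions {Ω : Type*} [MeasurableSpace Ω] (μ : Measure Ω) (T₀ : ℕ)
    (p : ℕ → ℕ) (X : ℕ → ℕ → ℕ → Ω → ℝ) (η : ℝ) (e : ℕ → Ω → ℝ) (γ' Cν K C' : ℝ) : Prop where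
  tail : ∀ β : (∀ T, Fin (p T) → ℝ), ∀ γ : ℝ, 2 ≤ γ → γ ≤ γ' → ∀ δ > (0 : ℝ), ∀ T ≥ T₀,
    μ.real {ω | δ < estError p X e β T ω} ≤ K * Cν * √((p T : ℝ) / T) ^ γ * δ ^ (-γ)
  bigOP : ∀ β : (∀ T, Fin (p T) → ℝ), ∀ ε > (0 : ℝ), ∃ M > (0 : ℝ), ∀ T ≥ T₀,
    μ.real {ω | M * √((p T : ℝ) / T) < estError p X e β T ω} ≤ ε
  meanSquare : ∀ β : (∀ T, Fin (p T) → ℝ), ∀ T ≥ T₀,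
    Integrable (fun ω => estError p X e β T ω ^ 2) μ ∧
    ∫ ω, estError p X e β T ω ^ 2 ∂μ ≤ meanSquareBound μ T₀ p X η Cν C' T
  bound_tendsto : Tendsto (meanSquareBound μ T₀ p X η Cν C') atTop (𝓝 0)

/-! ## The spatial factor / linear process error model -/

/-- The spatial domain `[0, 1]` in `ℝ^q`. -/
abbrev Site (q : ℕ) : Type := Set.Icc (0 : Fin q → ℝ) 1

/-- The data of the error model. The index `0` of `Fin (L + 1)` belongs to the idiosyncratic noise,
the index `ℓ + 1` to the `ℓ`-th factor. `site t k` is the location at which the lagged variable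
`U_{t-k}` is evaluated in the error at time `t`; both `site t k = s_t` and
`site t k = s_{t-k}` are allowed. -/
structure ErrorModel (Ω : Type*) (d q m L : ℕ) where
  u : Fin (L + 1) → ℤ → Ω → Fin d → ℝ
  Sig : Fin (L + 1) → ℤ → Matrix (Fin d) (Fin d) ℝ
  SigRoot : Fin (L + 1) → ℤ → Matrix (Fin d) (Fin d) ℝ
  coef : Fin (L + 1) → ℕ → Matrix (Fin d) (Fin d) ℝ
  load : Fin d → Fin L → ℝ
  prox : Site q → Site q → ℝ
  loc : Fin L → Site q
  H : Matrix (Fin d) (Fin (m + 1)) ℝ → Fin d → ℝ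
  site : ℕ → Fin (m + 1) → Site q

namespace ErrorModel

variable {Ω : Type*} {d q m L : ℕ} (M : ErrorModel Ω d q m L)

/-- The innovations `ε_t^{(ℓ)} = (Σ_t^{(ℓ)})^{1/2} u_t^{(ℓ)}`. -/
def innov (ℓ : Fin (L + 1)) (t : ℤ) (ω : Ω) : Fin d → ℝ :=
  (M.SigRoot ℓ t).mulVec (M.u ℓ t ω)

/-- The linear processes `∑_{j ≥ 0} C_j^{(ℓ)} ε_{t-j}^{(ℓ)}`. -/
def linProc (ℓ : Fin (L + 1)) (t : ℤ) (ω : Ω) : Fin d → ℝ :=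
  ∑' j : ℕ, (M.coef ℓ j).mulVec (M.innov ℓ (t - j) ω)

/-- `U_t^{(ν)}(s) = ∑_ℓ φ_{νℓ} d(s, r_ℓ) F_t^{(ℓ,ν)} + E_t^{(ν)}`. -/
def U (t : ℤ) (s : Site q) (ω : Ω) (ν : Fin d) : ℝ :=
  ∑ ℓ : Fin L, M.load ν ℓ * M.prox s (M.loc ℓ) * M.linProc ℓ.succ t ω ν + M.linProc 0 t ω ν

/-- The `d × (m+1)` matrix `(U_t, …, U_{t-m})`. -/
def window (t : ℕ) (ω : Ω) : Matrix (Fin d) (Fin (m + 1)) ℝ :=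
  Matrix.of fun ν k => M.U ((t : ℤ) - ((k : ℕ) : ℤ)) (M.site t k) ω ν

/-- The errors `ε_t^{(ν)} = H_ν(U_t, …, U_{t-m}) - E H_ν(U_t, …, U_{t-m})`. -/
def err [MeasurableSpace Ω] (μ : Measure Ω) (ν : Fin d) (t : ℕ) (ω : Ω) : ℝ :=
  M.H (M.window t ω) ν - ∫ ω', M.H (M.window t ω') ν ∂μ

/-- The assumptions on the errors, with fourth moments of the innovations and coefficients of
order `j^{-5-δ'}`. -/
structure Assumptions [MeasurableSpace Ω] (μ : Measure Ω) : Prop where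
  /-- The weight `d(u, v)` is a nonincreasing function of `‖u - v‖` for some norm, with
  values in `[0, 1]` and value `1` on the diagonal. -/
  prox_antitone : ∃ nrm : Seminorm ℝ (Fin q → ℝ), (∀ x, nrm x = 0 → x = 0) ∧
    ∀ u v u' v' : Site q, nrm ((u : Fin q → ℝ) - v) ≤ nrm ((u' : Fin q → ℝ) - v') →
      M.prox u' v' ≤ M.prox u v
  prox_mem : ∀ u v, M.prox u v ∈ Set.Icc (0 : ℝ) 1
  prox_self : ∀ u, M.prox u u = 1
  /-- `SigRoot` is the positive definite square root of the positive definite matrix `Sig`. -/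
  sig_posDef : ∀ ℓ t, (M.Sig ℓ t).PosDef
  sigRoot_posDef : ∀ ℓ t, (M.SigRoot ℓ t).PosDef
  sigRoot_sq : ∀ ℓ t, M.SigRoot ℓ t * M.SigRoot ℓ t = M.Sig ℓ t
  u_measurable : ∀ ℓ t, Measurable (M.u ℓ t)
  u_mean : ∀ ℓ t ν, ∫ ω, M.u ℓ t ω ν ∂μ = 0
  u_coord_indep : ∀ ℓ t, iIndepFun (fun (ν : Fin d) ω => M.u ℓ t ω ν) μ
  /-- Independent sequences of independent innovation vectors. -/
  innov_indep : iIndepFun (fun (i : Fin (L + 1) × ℤ) ω => M.innov i.1 i.2 ω) μ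
  /-- Uniformly bounded fourth moments. -/
  innov_moment : ∃ K : ℝ, ∀ ℓ t ν, Integrable (fun ω => |M.innov ℓ t ω ν| ^ 4) μ ∧
    ∫ ω, |M.innov ℓ t ω ν| ^ 4 ∂μ ≤ K
  /-- Bounded variances, and idiosyncratic variances bounded away from zero, if `d = 1`. -/
  var_le : d = 1 → ∃ K : ℝ, ∀ ℓ t ν, ∫ ω, M.innov ℓ t ω ν ^ 2 ∂μ ≤ K
  le_var : d = 1 → ∃ s > (0 : ℝ), ∀ t ν, s ≤ ∫ ω, M.innov 0 t ω ν ^ 2 ∂μ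
  /-- Smallest eigenvalue of the idiosyncratic matrices bounded away from zero, if `d > 1`. -/
  le_eigen : 1 < d → ∃ l > (0 : ℝ), ∀ t, spectrum ℝ (M.Sig 0 t) ⊆ Set.Ici l
  /-- The coordinates of the innovations have densities that are `L₁`-Lipschitz under shifts. -/
  density : ∀ ℓ ν, ∃ f : ℤ → ℝ → ℝ,
    (∀ t, Measurable (f t) ∧ (∀ z, 0 ≤ f t z) ∧
      μ.map (fun ω => M.innov ℓ t ω ν) = volume.withDensity (fun z => ENNReal.ofReal (f t z))) ∧
    ∃ K : ℝ, ∀ t ≥ 1, ∀ x : ℝ, ∫ z, |f t (z + x) - f t z| ≤ K * |x|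
  /-- Algebraic decay of the coefficients. -/
  decay : ∃ K : ℝ, ∃ δ' > (0 : ℝ), ∀ ℓ (j : ℕ) ν k,
    |M.coef ℓ j ν k| ≤ K * ((max j 1 : ℕ) : ℝ) ^ (-5 - δ')
  /-- `H_ν` is Lipschitz with respect to the Frobenius norm. -/
  lipschitz : ∃ LH : ℝ, ∀ ν x y, |M.H x ν - M.H y ν| ≤ LH * √(∑ i, ∑ k, (x i k - y i k) ^ 2)
  /-- There is a random matrix, independent of the `U_t`, at which `H` has fourth moments. -/
  exists_xi : ∃ Ξ : Ω → Fin d → Fin (m + 1) → ℝ, Measurable Ξ ∧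
    IndepFun Ξ (fun ω (i : ℤ × Site q) => M.U i.1 i.2 ω) μ ∧
    ∀ ν, Integrable (fun ω => |M.H (Matrix.of (Ξ ω)) ν| ^ 4) μ

end ErrorModel

/-! ## Networks with random weights -/

/-- The output of the `j`-th neuron of layer `k` of a feedforward network with input `z`, layer
widths `n`, weights `W k j i`, biases `b k j` and activation functions `g k j`:
`x_j^{(k)} = g_k (b_{jk} + ∑_{i < n_{k-1}} w_{ji}^{(k)} x_i^{(k-1)})`, with `x^{(0)} = z`. The activation
may depend on the neuron, so that a constant neuron (an intercept) is allowed. A single hidden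
layer net is the case `k = 1`. -/
def netOutput (g : ℕ → ℕ → ℝ → ℝ) (n : ℕ → ℕ) (W : ℕ → ℕ → ℕ → ℝ) (b : ℕ → ℕ → ℝ)
    (z : ℕ → ℝ) : ℕ → ℕ → ℝ
  | 0, i => z i
  | k + 1, j => g (k + 1) j
      (b (k + 1) j + ∑ i ∈ Finset.range (n k), W (k + 1) j i * netOutput g n W b z k i)

end

/-! ## Linear algebra and measurability -/

/-! The estimation error solves the normal equations: the Gram matrix maps it to the score vector `∑
x_t e_t` divided by `T`. A Gram matrix with spectrum above `l` expands norms by at least `l`, so the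
error is at most `(l T)⁻¹` times the norm of the score (`mul_estError_le`). Each of the `p` score
coordinates has `γ`-th moment at most `Cν T^(γ/2)`, and the power mean inequality turns this into a
`γ`-th error moment of order `(p/T)^(γ/2)` (`integrable_estError_rpow_and_integral_le`). Markov's
inequality with `l = a` gives the tail bound; `γ = 2` with `l = lamMin` gives the mean square bound.

For the error model only second moments of weighted sums are needed. Weights independent of the
innovations factor out of every mixed moment, so the matter reduces to absolutely summable
autocovariances (`exists_sum_abs_integral_err_mul_err_le`). Cutting the linear processes after `K`
lags changes the Lipschitz signal by `O(K⁻²)` in `L²`, and a signal cut so as to use only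
innovations later than `s` is uncorrelated with the signal at `s`. Hence the covariance at lag `k`
is `O(k⁻²)`, uniformly in time.

Network features are measurable functions of weights and inputs, hence independent of the
innovations. Frozen features are a deterministic design with the same bound `B`, and the moment
constant depends on the design only through `B`. -/

/-- A symmetric matrix with spectrum in `[l, ∞)` expands the Euclidean norm by at least `l`. -/
theorem mul_norm_le_norm_mulVec_of_le_spectrum {n : Type*} [Fintype n] [DecidableEq n]
    {A : Matrix n n ℝ} (hA : A.IsHermitian) {l : ℝ} (hl : ∀ x ∈ spectrum ℝ A, l ≤ x) (v : n → ℝ) :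
    l * ‖WithLp.toLp 2 v‖ ≤ ‖WithLp.toLp 2 (A.mulVec v)‖ := by
  -- The spectrum of `A - l` is that of `A` shifted into `[0, ∞)`. Positivity of this form and
  -- Cauchy–Schwarz then give the claim.
  have hps : (A - algebraMap ℝ (Matrix n n ℝ) l).PosSemidef := by
    rw [Matrix.posSemidef_iff_isHermitian_and_spectrum_nonneg]
    refine ⟨hA.sub ?_, ?_⟩
    · rw [Matrix.algebraMap_eq_diagonal]
      exact Matrix.isHermitian_diagonal _
    · rw [← spectrum.sub_singleton_eq]
      rintro _ ⟨x, hx, y, hy, rfl⟩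
      rw [Set.mem_singleton_iff] at hy
      subst hy
      exact sub_nonneg.2 (hl x hx)
  have h := hps.dotProduct_mulVec_nonneg v
  have hquad : l * ‖WithLp.toLp 2 v‖ ^ 2 ≤ inner ℝ (WithLp.toLp 2 v) (WithLp.toLp 2 (A.mulVec v)) := by
    rw [← real_inner_self_eq_norm_sq, EuclideanSpace.inner_toLp_toLp,
      EuclideanSpace.inner_toLp_toLp]
    simp only [star_trivial, Matrix.sub_mulVec, dotProduct_sub, Algebra.algebraMap_eq_smul_one,
      Matrix.smul_mulVec, Matrix.one_mulVec, dotProduct_smul, smul_eq_mul] at h ⊢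
    rw [dotProduct_comm (A.mulVec v)]
    linarith
  have hcs := hquad.trans (real_inner_le_norm _ _)
  rcases (norm_nonneg (WithLp.toLp 2 v)).eq_or_lt with h0 | hpos
  · rw [← h0]; simp
  · refine le_of_mul_le_mul_left ?_ hpos
    linarith

theorem measurable_matrix_det {Ω n : Type*} [MeasurableSpace Ω] [Fintype n] [DecidableEq n]
    {A : Ω → Matrix n n ℝ} (hA : ∀ i j, Measurable fun ω => A ω i j) :
    Measurable fun ω => (A ω).det := by
  simp only [Matrix.det_apply]
  exact Finset.measurable_sum _ fun σ _ =>
    (Finset.measurable_prod _ fun i _ => hA _ _).const_smul _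

/-- Cramer's rule writes each entry as a ratio of determinants. Singular matrices need no separate
treatment, as both inverses are then zero. -/
theorem measurable_matrix_inv {Ω n : Type*} [MeasurableSpace Ω] [Fintype n] [DecidableEq n]
    {A : Ω → Matrix n n ℝ} (hA : ∀ i j, Measurable fun ω => A ω i j) (i j : n) :
    Measurable fun ω => (A ω)⁻¹ i j := by
  simp only [Matrix.inv_def, Matrix.smul_apply, Ring.inverse_eq_inv', smul_eq_mul,
    Matrix.adjugate_apply]
  refine (measurable_matrix_det hA).inv.mul (measurable_matrix_det fun k l => ?_)
  simp only [Matrix.updateRow_apply]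
  split_ifs
  · exact measurable_const
  · exact hA k l

/-! ### Algebra and measurability of the least squares error. -/

section LeastSquares

variable {Ω : Type*} {p : ℕ → ℕ} {X : ℕ → ℕ → ℕ → Ω → ℝ}

theorem gramMatrix_isHermitian (T : ℕ) (ω : Ω) : (gramMatrix p X T ω).IsHermitian := by
  have h := Matrix.isHermitian_conjTranspose_mul_self (designMatrix p X T ω)
  rw [Matrix.conjTranspose_eq_transpose_of_trivial] at h
  rw [Matrix.IsHermitian, gramMatrix, Matrix.conjTranspose_smul, h.eq, star_trivial]

/-- The score coordinate `∑_{t=1}^T x_{tj} e_t`. -/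
theorem designMatrix_transpose_mulVec_apply (e : ℕ → Ω → ℝ) (T : ℕ) (ω : Ω) (j : Fin (p T)) :
    (designMatrix p X T ω).transpose.mulVec (fun t : Fin T => e (t + 1) ω) j =
      ∑ t ∈ Finset.Icc 1 T, X T t j ω * e t ω := by
  simp only [Matrix.mulVec, dotProduct, Matrix.transpose_apply, designMatrix, Matrix.of_apply]
  rw [Fin.sum_univ_eq_sum_range (fun t => X T (t + 1) j ω * e (t + 1) ω) T,
    Finset.range_eq_Ico, Finset.sum_Ico_add' (fun t => X T t j ω * e t ω) 0 T 1]
  rfl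

/-- The normal equations for the estimation error. -/
theorem gramMatrix_mulVec_leastSquares_sub (e : ℕ → Ω → ℝ) (β : ∀ T, Fin (p T) → ℝ) {T : ℕ}
    {ω : Ω} (h0 : (0 : ℝ) ∉ spectrum ℝ (gramMatrix p X T ω)) (hT : T ≠ 0) :
    (gramMatrix p X T ω).mulVec (leastSquares p X e β T ω - β T) =
      (T : ℝ)⁻¹ • fun j : Fin (p T) => ∑ t ∈ Finset.Icc 1 T, X T t j ω * e t ω := by
  have hT' : (T : ℝ)⁻¹ ≠ 0 := by positivity
  set D := designMatrix p X T ω with hD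
  have hU : IsUnit (D.transpose * D).det := by
    rw [spectrum.zero_notMem_iff, Matrix.isUnit_iff_isUnit_det, gramMatrix, Matrix.det_smul] at h0
    exact isUnit_of_mul_isUnit_right h0
  have hresp : response p X e β T ω = D.mulVec (β T) + fun t : Fin T => e (t + 1) ω := rfl
  have hdiff : (D.transpose * D).mulVec (leastSquares p X e β T ω) =
      D.transpose.mulVec (response p X e β T ω) := by
    rw [leastSquares, ← hD, Matrix.mulVec_mulVec, ← Matrix.mul_assoc, Matrix.mul_nonsing_inv _ hU,
      Matrix.one_mul]
  rw [gramMatrix, ← hD, Matrix.smul_mulVec, Matrix.mulVec_sub, hdiff, hresp, Matrix.mulVec_add,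
    Matrix.mulVec_mulVec, add_sub_cancel_left]
  congr 1
  ext j
  exact designMatrix_transpose_mulVec_apply e T ω j

/-- The spectral lower bound is applied to the normal equations. It holds pointwise in `ω`, so
random and fixed designs are treated alike. -/
theorem mul_estError_le (e : ℕ → Ω → ℝ) (β : ∀ T, Fin (p T) → ℝ) {T : ℕ} {ω : Ω} {l : ℝ}
    (hl : 0 < l) (hspec : ∀ x ∈ spectrum ℝ (gramMatrix p X T ω), l ≤ x) (hT : T ≠ 0) :
    estError p X e β T ω ≤
      l⁻¹ * (T : ℝ)⁻¹ * √(∑ j : Fin (p T), |∑ t ∈ Finset.Icc 1 T, X T t j ω * e t ω| ^ 2) := by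
  have h := mul_norm_le_norm_mulVec_of_le_spectrum (gramMatrix_isHermitian (p := p) (X := X) T ω)
    hspec (leastSquares p X e β T ω - β T)
  rw [gramMatrix_mulVec_leastSquares_sub e β (fun h => hl.not_ge (hspec 0 h)) hT, WithLp.toLp_smul,
    norm_smul] at h
  change l * estError p X e β T ω ≤ _ at h
  rw [EuclideanSpace.norm_eq] at h
  simp only [Real.norm_eq_abs, abs_inv, Nat.abs_cast] at h
  rw [mul_assoc]
  exact (le_inv_mul_iff₀ hl).2 h

theorem estError_nonneg (e : ℕ → Ω → ℝ) (β : ∀ T, Fin (p T) → ℝ) (T : ℕ) (ω : Ω) :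
    0 ≤ estError p X e β T ω := norm_nonneg _

/-- The case of no regressors is split off because there the growth assumption does not even force
`Cν ≥ 0`. -/
theorem estError_eq_zero_of_eq_zero (e : ℕ → Ω → ℝ) (β : ∀ T, Fin (p T) → ℝ) {T : ℕ}
    (hp : p T = 0) (ω : Ω) : estError p X e β T ω = 0 := by
  have : IsEmpty (Fin (p T)) := by rw [hp]; infer_instance
  rw [estError, EuclideanSpace.norm_eq]
  simp

theorem aemeasurable_estError [MeasurableSpace Ω] {μ : Measure Ω}
    (hX : ∀ T t j, Measurable (X T t j)) {e : ℕ → Ω → ℝ} (he : ∀ t, AEMeasurable (e t) μ)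
    (β : ∀ T, Fin (p T) → ℝ) (T : ℕ) : AEMeasurable (estError p X e β T) μ := by
  have hD : ∀ t j, Measurable fun ω => designMatrix p X T ω t j := fun t j => hX _ _ _
  have hInv := measurable_matrix_inv (A := fun ω =>
    (designMatrix p X T ω).transpose * designMatrix p X T ω) fun i j => by
      simp only [Matrix.mul_apply, Matrix.transpose_apply]
      exact Finset.measurable_sum _ fun t _ => (hD _ _).mul (hD _ _)
  have hLS : ∀ j, AEMeasurable (fun ω => leastSquares p X e β T ω j) μ := fun j => by
    simp only [leastSquares, Matrix.mulVec, dotProduct, Matrix.mul_apply, Matrix.transpose_apply,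
      response]
    refine Finset.aemeasurable_fun_sum _ fun t _ => ?_
    refine (Finset.measurable_sum _ fun i _ => (hInv j i).mul (hD _ _)).aemeasurable.mul ?_
    exact (Finset.measurable_sum _ fun i _ => (hD _ _).mul_const _).aemeasurable.add (he _)
  have : estError p X e β T = fun ω => √(∑ j, (leastSquares p X e β T ω j - β T j) ^ 2) := by
    ext ω
    rw [estError, EuclideanSpace.norm_eq]
    simp
  rw [this]
  exact (Finset.aemeasurable_fun_sum _ fun j _ => ((hLS j).sub_const _).pow_const _).sqrt

end LeastSquares

/-! ### From moments of the score to consistency. -/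

section Consistency

variable {Ω : Type*} [MeasurableSpace Ω] {μ : Measure Ω} {T₀ : ℕ} {p : ℕ → ℕ}
  {X : ℕ → ℕ → ℕ → Ω → ℝ}

/-- `lamMin` is at least `a` and bounds the spectra of all Gram matrices from below, if these lie
in `[a, b]`. -/
theorem le_lamMin_and_ae_lamMin_le [IsProbabilityMeasure μ] {a b : ℝ}
    (hspec : ∀ T ≥ T₀, ∀ᵐ ω ∂μ, spectrum ℝ (gramMatrix p X T ω) ⊆ Set.Icc a b)
    (hp : ∃ T ≥ T₀, p T ≠ 0) :
    a ≤ lamMin μ T₀ p X ∧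
      ∀ᵐ ω ∂μ, ∀ T ≥ T₀, ∀ x ∈ spectrum ℝ (gramMatrix p X T ω), lamMin μ T₀ p X ≤ x := by
  obtain ⟨T₁, hT₁, hp₁⟩ := hp
  have hall : ∀ᵐ ω ∂μ, ∀ T ≥ T₀, spectrum ℝ (gramMatrix p X T ω) ⊆ Set.Icc a b :=
    ae_all_iff.2 fun T => ae_all_iff.2 fun hT => hspec T hT
  set S : Ω → Set ℝ := fun ω => {l : ℝ | ∃ T ≥ T₀, l ∈ spectrum ℝ (gramMatrix p X T ω)} with hS
  -- Some `p T₁ ≠ 0` is essential: were all Gram matrices empty, `sInf ∅ = 0` would violate the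
  -- bound by `a`.
  have hne : ∀ ω, (S ω).Nonempty := fun ω =>
    ⟨_, T₁, hT₁, (gramMatrix_isHermitian (p := p) (X := X) T₁ ω).eigenvalues_mem_spectrum_real
      ⟨0, Nat.pos_of_ne_zero hp₁⟩⟩
  have hlow : ∀ᵐ ω ∂μ, a ≤ sInf (S ω) := hall.mono fun ω h =>
    le_csInf (hne ω) fun x ⟨T, hT, hx⟩ => (h T hT hx).1
  have hbdd : ∀ᵐ ω ∂μ, BddBelow (S ω) := hall.mono fun ω h =>
    ⟨a, fun x ⟨T, hT, hx⟩ => (h T hT hx).1⟩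
  have hup : ∀ᵐ ω ∂μ, sInf (S ω) ≤ b := by
    filter_upwards [hall, hbdd] with ω h hb
    obtain ⟨x, hx⟩ := hne ω
    obtain ⟨T, hT, hxT⟩ := id hx
    exact (csInf_le hb hx).trans (h T hT hxT).2
  -- The essential infimum is taken in `ℝ`, which is only conditionally complete, so bounds on both
  -- sides must be supplied.
  have hcob : IsCoboundedUnder (· ≥ ·) (ae μ) fun ω => sInf (S ω) :=
    IsBoundedUnder.isCoboundedUnder_ge ⟨b, hup⟩
  have hbd : IsBoundedUnder (· ≥ ·) (ae μ) fun ω => sInf (S ω) := ⟨a, hlow⟩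
  refine ⟨le_essInf_of_ae_le a hlow hcob, ?_⟩
  filter_upwards [ae_essInf_le hbd, hbdd] with ω h hb T hT x hx
  exact h.trans (csInf_le hb ⟨T, hT, hx⟩)

/-- The moment of order `γ` of the estimation error under the growth of sum moment assumption. -/
theorem integrable_estError_rpow_and_integral_le
    (hX : ∀ T t j, Measurable (X T t j)) {e : ℕ → Ω → ℝ} (he : ∀ t, AEMeasurable (e t) μ)
    {γ' Cν : ℝ} (hG : GrowthOfSumMoment μ T₀ p X e γ' Cν) (β : ∀ T, Fin (p T) → ℝ) {γ : ℝ}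
    (h2 : 2 ≤ γ) (hγ : γ ≤ γ') {T : ℕ} (hT : T₀ ≤ T) (hT1 : 1 ≤ T) (hp : p T ≠ 0) {l : ℝ}
    (hl : 0 < l) (hspec : ∀ᵐ ω ∂μ, ∀ x ∈ spectrum ℝ (gramMatrix p X T ω), l ≤ x) :
    Integrable (fun ω => estError p X e β T ω ^ γ) μ ∧
      ∫ ω, estError p X e β T ω ^ γ ∂μ ≤ l⁻¹ ^ γ * Cν * √((p T : ℝ) / T) ^ γ := by
  set S : Fin (p T) → Ω → ℝ := fun j ω => |∑ t ∈ Finset.Icc 1 T, X T t j ω * e t ω| with hS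
  have hγ0 : 0 ≤ γ := by linarith
  have hT0 : (0 : ℝ) < T := by exact_mod_cast hT1
  have hp0 : (0 : ℝ) < p T := by exact_mod_cast Nat.pos_of_ne_zero hp
  -- The power of `p` comes from the power mean inequality with exponent `γ / 2 ≥ 1` on the `p`
  -- squared score coordinates.
  set c : ℝ := l⁻¹ ^ γ * (T : ℝ)⁻¹ ^ γ * (p T : ℝ) ^ (γ / 2 - 1) with hc
  have hint : Integrable (fun ω => c * ∑ j, S j ω ^ γ) μ :=
    (integrable_finsetSum Finset.univ fun (j : Fin (p T)) _ =>
      (hG γ h2 hγ T hT T j j.2).1).const_mul c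
  have hle : ∀ᵐ ω ∂μ, estError p X e β T ω ^ γ ≤ c * ∑ j, S j ω ^ γ := by
    filter_upwards [hspec] with ω hω
    have h1 := Real.rpow_le_rpow (estError_nonneg e β T ω)
      (mul_estError_le e β hl hω (by lia)) hγ0
    refine h1.trans ?_
    rw [Real.mul_rpow (by positivity) (by positivity), Real.mul_rpow (by positivity) (by positivity),
      hc, mul_assoc (_ * _)]
    refine mul_le_mul_of_nonneg_left ?_ (by positivity)
    rw [Real.sqrt_eq_rpow, ← Real.rpow_mul (by positivity)]
    have h3 := Real.rpow_sum_le_const_mul_sum_rpow Finset.univ (fun j => S j ω ^ 2)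
      (p := γ / 2) (by linarith)
    have h4 : ∀ j, |S j ω ^ 2| ^ (γ / 2) = S j ω ^ γ := fun j => by
      rw [abs_of_nonneg (by positivity), ← Real.rpow_natCast, ← Real.rpow_mul (abs_nonneg _)]
      congr 1
      push_cast
      ring
    simp only [h4, Finset.card_univ, Fintype.card_fin] at h3
    simp only [hS, abs_pow, abs_abs] at h3
    rw [one_div_mul_eq_div]
    exact h3
  have hmeas : AEStronglyMeasurable (fun ω => estError p X e β T ω ^ γ) μ :=
    ((aemeasurable_estError hX he β T).pow_const γ).aestronglyMeasurable
  have hI : Integrable (fun ω => estError p X e β T ω ^ γ) μ := by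
    refine hint.mono' hmeas ?_
    filter_upwards [hle] with ω hω
    rwa [Real.norm_of_nonneg (Real.rpow_nonneg (estError_nonneg e β T ω) _)]
  refine ⟨hI, (integral_mono_ae hI hint hle).trans ?_⟩
  rw [integral_const_mul, integral_finsetSum Finset.univ fun (j : Fin (p T)) _ => (hG γ h2 hγ T hT T j j.2).1]
  calc c * ∑ j, ∫ ω, S j ω ^ γ ∂μ
      ≤ c * ∑ _j : Fin (p T), Cν * (T : ℝ) ^ (γ / 2) := by
        refine mul_le_mul_of_nonneg_left ?_ (by positivity)
        exact Finset.sum_le_sum fun j _ => (hG γ h2 hγ T hT T j j.2).2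
    -- Summation over coordinates turns `p^(γ/2-1)` into `p^(γ/2)`, and `T^(-γ) T^(γ/2) = T^(-γ/2)`.
    _ = l⁻¹ ^ γ * Cν * √((p T : ℝ) / T) ^ γ := by
        rw [Finset.sum_const, Finset.card_univ, Fintype.card_fin, nsmul_eq_mul, hc,
          Real.sqrt_eq_rpow, ← Real.rpow_mul (by positivity), Real.div_rpow hp0.le hT0.le,
          Real.rpow_sub_one hp0.ne', Real.inv_rpow hT0.le,
          show γ = γ / 2 + γ / 2 by ring, Real.rpow_add hT0]
        have := Real.rpow_pos_of_pos hT0 (γ / 2)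
        rw [show 1 / 2 * (γ / 2 + γ / 2) = γ / 2 by ring,
          show (γ / 2 + γ / 2) / 2 = γ / 2 by ring]
        field_simp

/-- Under the rate condition, `p = o(T)` and `p^η / √T` is bounded. -/
theorem RateCondition.tendsto_and_bounded {η : ℝ} (hη : 0 ≤ η) (h : RateCondition T₀ p η) :
    Tendsto (fun T => (p T : ℝ) / T) atTop (𝓝 0) ∧
      ∀ᶠ T : ℕ in atTop, (p T : ℝ) ^ η / √(T : ℝ) ≤ 1 := by
  rcases le_or_gt η (1 / 2) with h1 | h1
  · obtain ⟨hpT, ht⟩ := h.1 h1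
    refine ⟨ht, ?_⟩
    filter_upwards [eventually_ge_atTop T₀, eventually_ge_atTop 1] with T hT hT1
    have hT1' : (1 : ℝ) ≤ T := by exact_mod_cast hT1
    rw [div_le_one (by positivity), Real.sqrt_eq_rpow]
    calc (p T : ℝ) ^ η ≤ (T : ℝ) ^ η :=
          Real.rpow_le_rpow (by positivity) (by exact_mod_cast hpT T hT) hη
      _ ≤ (T : ℝ) ^ (1 / 2 : ℝ) := Real.rpow_le_rpow_of_exponent_le hT1' h1
  · have ht := h.2 h1
    constructor
    · refine squeeze_zero (fun T => by positivity) (fun T => ?_) ht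
      gcongr
      rcases Nat.eq_zero_or_pos (p T) with h0 | h0
      · rw [h0, Nat.cast_zero]; positivity
      · exact Real.self_le_rpow_of_one_le (by exact_mod_cast h0) (by linarith)
    · filter_upwards [ht.eventually (gt_mem_nhds one_pos), eventually_ge_atTop 1] with T hT hT1
      have hT0 : (0 : ℝ) < T := by exact_mod_cast hT1
      rw [div_le_one (by positivity)]
      refine Real.le_sqrt_of_sq_le ?_
      rw [div_lt_one hT0, mul_comm, Real.rpow_mul (by positivity), Real.rpow_two] at hT
      exact hT.le

/-- The squared factor is eventually bounded, since `p^η / √T ≤ 1` and `lamMin` does not depend on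
`T`; the remaining factor `p / T` tends to zero. -/
theorem RateCondition.tendsto_meanSquareBound {η : ℝ} (hη : 0 ≤ η) (h : RateCondition T₀ p η)
    (Cν : ℝ) : Tendsto (meanSquareBound μ T₀ p X η Cν 1) atTop (𝓝 0) := by
  obtain ⟨ht, hb⟩ := h.tendsto_and_bounded hη
  unfold meanSquareBound
  refine bdd_le_mul_tendsto_zero' ((1 + |(lamMin μ T₀ p X)⁻¹|) ^ 2 * |Cν|) ?_ ht
  filter_upwards [hb] with T hT
  rw [abs_mul, abs_pow, one_mul]
  gcongr
  refine (abs_add_le _ _).trans ?_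
  rw [abs_of_nonneg (by positivity)]
  gcongr

/-- Consistency of least squares with explicit constants, which depend only on the lower bound `a`
of the spectra and on `γ'`. -/
theorem consistencyAssertions_of_growthOfSumMoment [IsProbabilityMeasure μ] (hT₀ : 1 ≤ T₀)
    (hX : ∀ T t j, Measurable (X T t j)) {Sx : ∀ T, Matrix (Fin (p T)) (Fin (p T)) ℝ}
    {B η C a b : ℝ} (hreg : RegressorAssumption μ T₀ p X Sx B η C a b)
    (hrate : RateCondition T₀ p η) {γ' : ℝ} (hγ' : 2 ≤ γ') {e : ℕ → Ω → ℝ}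
    (he : ∀ t, AEMeasurable (e t) μ) {Cν : ℝ} (hG : GrowthOfSumMoment μ T₀ p X e γ' Cν) :
    ConsistencyAssertions μ T₀ p X η e γ' Cν (max 1 a⁻¹ ^ γ') 1 := by
  have ha := hreg.a_pos
  -- The sign of `Cν` can be read off from the growth bound at `N = 1`.
  have hCν : ∀ T ≥ T₀, p T ≠ 0 → 0 ≤ Cν := fun T hT hp => by
    have h := (hG 2 le_rfl hγ' T hT 1 0 (Nat.pos_of_ne_zero hp)).2
    rw [Nat.cast_one, Real.one_rpow, mul_one] at h
    exact (integral_nonneg fun ω => by positivity).trans h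
  have htail : ∀ β : (∀ T, Fin (p T) → ℝ), ∀ γ : ℝ, 2 ≤ γ → γ ≤ γ' → ∀ δ > (0 : ℝ), ∀ T ≥ T₀,
      μ.real {ω | δ < estError p X e β T ω} ≤
        max 1 a⁻¹ ^ γ' * Cν * √((p T : ℝ) / T) ^ γ * δ ^ (-γ) := by
    intro β γ h2 hγ δ hδ T hT
    by_cases hp : p T = 0
    · have : {ω | δ < estError p X e β T ω} = ∅ := by
        ext ω
        simp [estError_eq_zero_of_eq_zero e β hp, hδ.le]
      rw [this, hp]
      simp [Real.zero_rpow (show γ ≠ 0 by linarith)]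
    · obtain ⟨hI, hle⟩ := integrable_estError_rpow_and_integral_le hX he hG β h2 hγ hT
        (hT₀.trans hT) hp ha ((hreg.spec T hT).mono fun ω h x hx => (h hx).1)
      have hmarkov := mul_meas_ge_le_integral_of_nonneg (μ := μ)
        (ae_of_all _ fun ω => Real.rpow_nonneg (estError_nonneg e β T ω) γ) hI (δ ^ γ)
      have hsub : μ.real {ω | δ < estError p X e β T ω} ≤
          μ.real {ω | δ ^ γ ≤ estError p X e β T ω ^ γ} :=
        measureReal_mono fun ω (hω : δ < _) => Real.rpow_le_rpow hδ.le hω.le (by linarith)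
      have hδγ := Real.rpow_pos_of_pos hδ γ
      -- The maximum with `1` makes the constant uniform over `γ ≤ γ'`.
      have hK : a⁻¹ ^ γ ≤ max 1 a⁻¹ ^ γ' :=
        (Real.rpow_le_rpow (by positivity) (le_max_right 1 _) (by linarith)).trans
          (Real.rpow_le_rpow_of_exponent_le (le_max_left _ _) hγ)
      rw [Real.rpow_neg hδ.le, ← div_eq_mul_inv, le_div_iff₀ hδγ, mul_comm]
      refine (mul_le_mul_of_nonneg_left hsub hδγ.le).trans (hmarkov.trans (hle.trans ?_))
      have := hCν T hT hp
      gcongr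
  refine ⟨htail, fun β ε hε => ?_, fun β T hT => ?_, hrate.tendsto_meanSquareBound hreg.eta_nonneg Cν⟩
  · set κ : ℝ := max 1 a⁻¹ ^ γ' * |Cν| with hκ
    have hκ0 : 0 ≤ κ := by positivity
    -- With this `M` the tail bound at `γ = 2` equals `κ / (κ + 1) * ε`; adding `1` covers `κ = 0`.
    refine ⟨√((κ + 1) / ε), by positivity, fun T hT => ?_⟩
    by_cases hp : p T = 0
    · have : {ω | √((κ + 1) / ε) * √((p T : ℝ) / T) < estError p X e β T ω} = ∅ := by
        ext ω
        simp [estError_eq_zero_of_eq_zero e β hp, hp]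
      rw [this]
      simpa using hε.le
    · have hT0 : (0 : ℝ) < T := by exact_mod_cast hT₀.trans hT
      have hp0 : (0 : ℝ) < p T := by exact_mod_cast Nat.pos_of_ne_zero hp
      refine (htail β 2 le_rfl hγ' _ (by positivity) T hT).trans ?_
      rw [Real.rpow_neg (by positivity), Real.rpow_two, Real.rpow_two, mul_pow,
        Real.sq_sqrt (by positivity), Real.sq_sqrt (by positivity), ← abs_of_nonneg (hCν T hT hp),
        ← hκ]
      have : κ * ((p T : ℝ) / T) * ((κ + 1) / ε * ((p T : ℝ) / T))⁻¹ = κ / (κ + 1) * ε := by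
        field_simp
      rw [this]
      exact mul_le_of_le_one_left hε.le ((div_le_one (by linarith)).2 (by linarith))
  · by_cases hp : p T = 0
    · simp [estError_eq_zero_of_eq_zero e β hp, meanSquareBound, hp]
    -- Taking `l = lamMin` already gives the bound without the term `C' p^η / √T`. That term is
    -- nonnegative slack, so `C' = 1` works.
    · obtain ⟨hal, hlam⟩ := le_lamMin_and_ae_lamMin_le hreg.spec ⟨T, hT, hp⟩
      have hl0 := ha.trans_le hal
      obtain ⟨hI, hle⟩ := integrable_estError_rpow_and_integral_le hX he hG β le_rfl hγ' hT
        (hT₀.trans hT) hp hl0 (hlam.mono fun ω h => h T hT)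
      simp only [Real.rpow_two] at hI hle
      refine ⟨hI, hle.trans ?_⟩
      rw [Real.sq_sqrt (by positivity), meanSquareBound]
      have := hCν T hT hp
      gcongr
      rw [one_mul]
      exact le_add_of_nonneg_left (by positivity)

end Consistency

/-! ## Square integrable series and covariances -/

section SquareIntegrable

variable {Ω : Type*} [MeasurableSpace Ω] {μ : Measure Ω}

/-- The sum of the series `∑ (j + 1)⁻²`. -/
noncomputable def invSqSum : ℝ := ∑' j : ℕ, (((j : ℝ) + 1) ^ 2)⁻¹

theorem summable_inv_succ_sq : Summable fun j : ℕ => (((j : ℝ) + 1) ^ 2)⁻¹ := by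
  have h := (summable_nat_add_iff 1).2 (Real.summable_nat_pow_inv.2 (one_lt_two))
  simpa using h

theorem invSqSum_nonneg : 0 ≤ invSqSum := tsum_nonneg fun _ => by positivity

/-- Two of the four factors are bounded by `(K + 1)⁻¹` and the other two by `(j + 1)⁻¹`, which keeps
the sum finite. -/
theorem sum_inv_add_pow_four_le (K R : ℕ) :
    ∑ j ∈ Finset.range R, (((j + K : ℕ) : ℝ) + 1)⁻¹ ^ 4 ≤ invSqSum * (((K : ℝ) + 1) ^ 2)⁻¹ := by
  calc ∑ j ∈ Finset.range R, (((j + K : ℕ) : ℝ) + 1)⁻¹ ^ 4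
      ≤ ∑ j ∈ Finset.range R, (((j : ℝ) + 1) ^ 2)⁻¹ * (((K : ℝ) + 1) ^ 2)⁻¹ := by
        refine Finset.sum_le_sum fun j _ => ?_
        have hj : (((j + K : ℕ) : ℝ) + 1)⁻¹ ≤ ((j : ℝ) + 1)⁻¹ := by
          push_cast; gcongr; linarith [(Nat.cast_nonneg K : (0 : ℝ) ≤ K)]
        have hK : (((j + K : ℕ) : ℝ) + 1)⁻¹ ≤ ((K : ℝ) + 1)⁻¹ := by
          push_cast; gcongr; linarith [(Nat.cast_nonneg j : (0 : ℝ) ≤ j)]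
        rw [← inv_pow, ← inv_pow, show 4 = 2 + 2 from rfl, pow_add]
        gcongr
    _ ≤ invSqSum * (((K : ℝ) + 1) ^ 2)⁻¹ := by
        rw [← Finset.sum_mul]
        gcongr
        exact summable_inv_succ_sq.sum_le_tsum _ fun _ _ => by positivity

/-- A series whose terms decay like `j⁻⁴` in `L²` converges almost surely, and its remainders decay
like `K⁻²` in `L²`. -/
theorem ae_summable_and_eLpNorm_tsum_sub_le [IsProbabilityMeasure μ] {f : ℕ → Ω → ℝ}
    (hf : ∀ j, AEStronglyMeasurable (f j) μ) {c : ℝ} (hc : 0 ≤ c)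
    (hle : ∀ j, eLpNorm (f j) 2 μ ≤ ENNReal.ofReal (c * ((j : ℝ) + 1)⁻¹ ^ 4)) :
    (∀ᵐ ω ∂μ, Summable fun j => f j ω) ∧ ∀ K : ℕ,
      eLpNorm (fun ω => ∑' j, f j ω - ∑ j ∈ Finset.range K, f j ω) 2 μ ≤
        ENNReal.ofReal (c * invSqSum * (((K : ℝ) + 1) ^ 2)⁻¹) := by
  have hpart : ∀ K R : ℕ, ∑ j ∈ Finset.range R, eLpNorm (f (j + K)) 2 μ ≤
      ENNReal.ofReal (c * invSqSum * (((K : ℝ) + 1) ^ 2)⁻¹) := fun K R => by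
    refine (Finset.sum_le_sum fun j _ => hle (j + K)).trans ?_
    rw [← ENNReal.ofReal_sum_of_nonneg fun _ _ => by positivity, ← Finset.mul_sum, mul_assoc]
    exact ENNReal.ofReal_le_ofReal (mul_le_mul_of_nonneg_left (sum_inv_add_pow_four_le K R) hc)
  have hsum : ∀ᵐ ω ∂μ, Summable fun j => f j ω := by
    -- On a probability space `L¹` norms are at most `L²` norms, so the expected sum of absolute
    -- values is finite.
    have hfin : ∫⁻ ω, ∑' j, ‖f j ω‖ₑ ∂μ ≠ ⊤ := by
      rw [lintegral_tsum fun j => (hf j).enorm]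
      refine ne_top_of_le_ne_top (ENNReal.ofReal_ne_top) (ENNReal.tsum_le_of_sum_range_le
        fun R => ?_) (b := ENNReal.ofReal (c * invSqSum * ((((0 : ℕ) : ℝ) + 1) ^ 2)⁻¹))
      refine le_trans (Finset.sum_le_sum fun j _ => ?_) (hpart 0 R)
      rw [← eLpNorm_one_eq_lintegral_enorm]
      exact eLpNorm_le_eLpNorm_of_exponent_le (by norm_num) (hf j)
    filter_upwards [ae_lt_top' (AEMeasurable.tsum fun j => (hf j).enorm) hfin] with ω hω
    exact Summable.of_norm (by
      simpa using ENNReal.summable_toReal hω.ne)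
  refine ⟨hsum, fun K => ?_⟩
  -- The remainder is an almost sure limit of finite blocks, so Fatou's lemma carries their `L²`
  -- bound over.
  have hlim : ∀ᵐ ω ∂μ, Tendsto (fun R => (∑ j ∈ Finset.range R, f (j + K)) ω) atTop
      (𝓝 (∑' j, f j ω - ∑ j ∈ Finset.range K, f j ω)) := by
    filter_upwards [hsum] with ω hω
    simp only [Finset.sum_apply]
    exact ((hasSum_nat_add_iff' K).2 hω.hasSum).tendsto_sum_nat
  refine (Lp.eLpNorm_lim_le_liminf_eLpNorm (fun R => Finset.aestronglyMeasurable_sum _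
    fun j _ => hf (j + K)) _ hlim).trans ?_
  refine (liminf_le_liminf (Eventually.of_forall fun R => ?_)).trans (liminf_const _).le
  exact (eLpNorm_sum_le (fun j _ => hf (j + K)) (by norm_num)).trans (hpart K R)

theorem abs_integral_mul_le_of_eLpNorm_le {f g : Ω → ℝ} (hf : MemLp f 2 μ) (hg : MemLp g 2 μ)
    {A B : ℝ} (hA : 0 ≤ A) (hB : 0 ≤ B) (hfA : eLpNorm f 2 μ ≤ ENNReal.ofReal A)
    (hgB : eLpNorm g 2 μ ≤ ENNReal.ofReal B) : |∫ ω, f ω * g ω ∂μ| ≤ A * B := by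
  have hin : inner ℝ (hf.toLp f) (hg.toLp g) = ∫ ω, f ω * g ω ∂μ := by
    rw [L2.inner_def]
    refine integral_congr_ae ?_
    filter_upwards [hf.coeFn_toLp, hg.coeFn_toLp] with ω h1 h2
    rw [h1, h2, mul_comm]
    rfl
  rw [← hin]
  refine (abs_real_inner_le_norm _ _).trans ?_
  rw [Lp.norm_toLp, Lp.norm_toLp]
  exact mul_le_mul (ENNReal.toReal_le_of_le_ofReal hA hfA) (ENNReal.toReal_le_of_le_ofReal hB hgB)
    ENNReal.toReal_nonneg hA

/-- Cauchy–Schwarz bounds `E fg` and `E f · E g` separately, whence the factor `2`. -/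
theorem abs_covariance_le_of_eLpNorm_le [IsProbabilityMeasure μ] {f g : Ω → ℝ} (hf : MemLp f 2 μ)
    (hg : MemLp g 2 μ) {A B : ℝ} (hA : 0 ≤ A) (hB : 0 ≤ B)
    (hfA : eLpNorm f 2 μ ≤ ENNReal.ofReal A) (hgB : eLpNorm g 2 μ ≤ ENNReal.ofReal B) :
    |cov[f, g; μ]| ≤ 2 * (A * B) := by
  have h1 : eLpNorm (fun _ : Ω => (1 : ℝ)) 2 μ ≤ ENNReal.ofReal 1 := by
    rw [eLpNorm_const _ (by norm_num) (NeZero.ne μ)]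
    simp
  have hfm := abs_integral_mul_le_of_eLpNorm_le hf (memLp_const 1) hA zero_le_one hfA h1
  have hgm := abs_integral_mul_le_of_eLpNorm_le hg (memLp_const 1) hB zero_le_one hgB h1
  have hfg := abs_integral_mul_le_of_eLpNorm_le hf hg hA hB hfA hgB
  simp only [mul_one] at hfm hgm
  rw [covariance_eq_sub hf hg]
  refine (abs_sub _ _).trans ?_
  rw [abs_mul, two_mul]
  exact add_le_add hfg (mul_le_mul hfm hgm (abs_nonneg _) hA)

end SquareIntegrable

/-! ## Short range dependence of the errors -/

namespace ErrorModel

variable {Ω : Type*} {d q m L : ℕ} (M : ErrorModel Ω d q m L)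

/-- The window matrix at time `t` built from an array of factors. -/
def windowOf (F : Fin (L + 1) → ℤ → Fin d → ℝ) (t : ℕ) : Fin d → Fin (m + 1) → ℝ :=
  fun ν k => ∑ ℓ : Fin L, M.load ν ℓ * M.prox (M.site t k) (M.loc ℓ) *
    F ℓ.succ ((t : ℤ) - ((k : ℕ) : ℤ)) ν + F 0 ((t : ℤ) - ((k : ℕ) : ℤ)) ν

/-- The linear processes truncated after `K` lags. -/
def truncLinProc (K : ℕ) (ℓ : Fin (L + 1)) (t : ℤ) (ω : Ω) : Fin d → ℝ :=
  ∑ j ∈ Finset.range K, (M.coef ℓ j).mulVec (M.innov ℓ (t - j) ω)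

/-- `H_ν(U_t, …, U_{t-m})`. -/
noncomputable def signal (ν : Fin d) (t : ℕ) (ω : Ω) : ℝ :=
  M.H (Matrix.of (M.windowOf (fun ℓ τ => M.linProc ℓ τ ω) t)) ν

/-- `H_ν(U_t, …, U_{t-m})` with all linear processes truncated after `K` lags. -/
noncomputable def truncSignal (ν : Fin d) (K t : ℕ) (ω : Ω) : ℝ :=
  M.H (Matrix.of (M.windowOf (fun ℓ τ => M.truncLinProc K ℓ τ ω) t)) ν

/-- The total size of the loadings. -/
noncomputable def loadSum : ℝ := 1 + ∑ ν, ∑ ℓ, |M.load ν ℓ|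

theorem loadSum_pos : 0 < M.loadSum :=
  add_pos_of_pos_of_nonneg one_pos (Finset.sum_nonneg fun _ _ => Finset.sum_nonneg fun _ _ =>
    abs_nonneg _)

theorem abs_load_le_loadSum (ν : Fin d) (ℓ : Fin L) : |M.load ν ℓ| ≤ M.loadSum := by
  have h1 := Finset.single_le_sum (f := fun ℓ => |M.load ν ℓ|) (fun _ _ => abs_nonneg _)
    (Finset.mem_univ ℓ)
  have h2 := Finset.single_le_sum (f := fun ν => ∑ ℓ, |M.load ν ℓ|)
    (fun _ _ => Finset.sum_nonneg fun _ _ => abs_nonneg _) (Finset.mem_univ ν)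
  unfold loadSum
  linarith

theorem one_le_loadSum : 1 ≤ M.loadSum :=
  le_add_of_nonneg_right (Finset.sum_nonneg fun _ _ => Finset.sum_nonneg fun _ _ => abs_nonneg _)

/-- Proximities lie in `[0, 1]`, and the `1` in `loadSum` covers the unit coefficient of the
idiosyncratic noise, so one constant serves all terms. -/
theorem abs_windowOf_sub_le (hprox : ∀ u v, M.prox u v ∈ Set.Icc (0 : ℝ) 1)
    (F F' : Fin (L + 1) → ℤ → Fin d → ℝ) (t : ℕ) (ν : Fin d) (k : Fin (m + 1)) :
    |M.windowOf F t ν k - M.windowOf F' t ν k| ≤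
      ∑ ℓ, M.loadSum * |F ℓ ((t : ℤ) - ((k : ℕ) : ℤ)) ν - F' ℓ ((t : ℤ) - ((k : ℕ) : ℤ)) ν| := by
  rw [Fin.sum_univ_succ, add_comm]
  have : M.windowOf F t ν k - M.windowOf F' t ν k =
      ∑ ℓ : Fin L, M.load ν ℓ * M.prox (M.site t k) (M.loc ℓ) *
        (F ℓ.succ ((t : ℤ) - ((k : ℕ) : ℤ)) ν - F' ℓ.succ ((t : ℤ) - ((k : ℕ) : ℤ)) ν) +
      (F 0 ((t : ℤ) - ((k : ℕ) : ℤ)) ν - F' 0 ((t : ℤ) - ((k : ℕ) : ℤ)) ν) := by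
    simp only [windowOf, mul_sub, Finset.sum_sub_distrib]
    ring
  rw [this]
  refine (abs_add_le _ _).trans (add_le_add ((Finset.abs_sum_le_sum_abs _ _).trans
    (Finset.sum_le_sum fun ℓ _ => ?_)) (le_mul_of_one_le_left (abs_nonneg _) M.one_le_loadSum))
  rw [abs_mul, abs_mul, abs_of_nonneg (hprox _ _).1]
  refine mul_le_mul_of_nonneg_right ?_ (abs_nonneg _)
  exact (mul_le_of_le_one_right (abs_nonneg _) (hprox _ _).2).trans (M.abs_load_le_loadSum ν ℓ)

/-- A deterministic reference point: square integrability of the signal follows from the truncation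
error at `K = 0`. -/
theorem truncSignal_zero (ν : Fin d) (t : ℕ) :
    M.truncSignal ν 0 t = fun _ => M.H (Matrix.of fun _ _ => 0) ν := by
  ext ω
  have : M.windowOf (fun ℓ τ => M.truncLinProc 0 ℓ τ ω) t = fun _ _ => 0 := by
    ext i k
    simp [windowOf, truncLinProc]
  rw [truncSignal, this]

variable [MeasurableSpace Ω]

namespace Assumptions

variable {M} {μ : Measure Ω}

/-- This supplies the measurability of `H`, needed for all signals. -/
theorem continuous_H (hM : M.Assumptions μ) (ν : Fin d) :
    Continuous fun x : Fin d → Fin (m + 1) → ℝ => M.H (Matrix.of x) ν := by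
  obtain ⟨LH, hLH⟩ := hM.lipschitz
  rw [continuous_iff_continuousAt]
  intro y
  rw [ContinuousAt, tendsto_iff_dist_tendsto_zero]
  have hc : Continuous fun x : Fin d → Fin (m + 1) → ℝ =>
      LH * √(∑ i, ∑ k, (x i k - y i k) ^ 2) := by fun_prop
  refine squeeze_zero (fun _ => dist_nonneg) (fun x => hLH ν (Matrix.of x) (Matrix.of y)) ?_
  simpa using hc.tendsto y

/-- The Frobenius norm is dominated by the sum of absolute entries, which makes the bound additive
over factors and ready for Minkowski's inequality. -/
theorem exists_abs_H_windowOf_sub_le (hM : M.Assumptions μ) : ∃ c : ℝ, 0 ≤ c ∧ ∀ (ν : Fin d) F F' t,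
    |M.H (Matrix.of (M.windowOf F t)) ν - M.H (Matrix.of (M.windowOf F' t)) ν| ≤
      ∑ i, ∑ k : Fin (m + 1), ∑ ℓ,
        c * |F ℓ ((t : ℤ) - ((k : ℕ) : ℤ)) i - F' ℓ ((t : ℤ) - ((k : ℕ) : ℤ)) i| := by
  obtain ⟨LH, hLH⟩ := hM.lipschitz
  refine ⟨|LH| * M.loadSum, mul_nonneg (abs_nonneg _) M.loadSum_pos.le, fun ν F F' t => ?_⟩
  refine (hLH ν _ _).trans ?_
  refine (mul_le_mul (le_abs_self LH) (?_ : _ ≤ ∑ i, ∑ k, |M.windowOf F t i k - M.windowOf F' t i k|)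
    (Real.sqrt_nonneg _) (abs_nonneg _)).trans ?_
  · refine Real.sqrt_le_iff.2 ⟨by positivity, ?_⟩
    simp only [← Finset.sum_product', Matrix.of_apply]
    refine le_trans (Finset.sum_le_sum fun x _ => (sq_abs _).symm.le) ?_
    exact Finset.sum_sq_le_sq_sum_of_nonneg fun _ _ => abs_nonneg _
  · rw [Finset.mul_sum]
    refine Finset.sum_le_sum fun i _ => ?_
    rw [Finset.mul_sum]
    refine Finset.sum_le_sum fun k _ => ?_
    simp only [mul_assoc]
    rw [← Finset.mul_sum]
    exact mul_le_mul_of_nonneg_left (M.abs_windowOf_sub_le hM.prox_mem F F' t i k) (abs_nonneg _)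

theorem measurable_innov (hM : M.Assumptions μ) (ℓ : Fin (L + 1)) (t : ℤ) : Measurable (M.innov ℓ t) :=
  (Continuous.matrix_mulVec continuous_const continuous_id).measurable.comp (hM.u_measurable ℓ t)

theorem measurable_H_windowOf (hM : M.Assumptions μ) {Ω' : Type*} [MeasurableSpace Ω']
    {F : Fin (L + 1) → ℤ → Ω' → Fin d → ℝ} (hF : ∀ ℓ t, Measurable (F ℓ t)) (ν : Fin d) (t : ℕ) :
    Measurable fun ω => M.H (Matrix.of (M.windowOf (fun ℓ τ => F ℓ τ ω) t)) ν := by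
  refine (hM.continuous_H ν).measurable.comp (measurable_pi_lambda _ fun i =>
    measurable_pi_lambda _ fun k => ?_)
  exact (Finset.measurable_sum _ fun ℓ _ =>
    ((measurable_pi_apply i).comp (hF ℓ.succ _)).const_mul _).add
      ((measurable_pi_apply i).comp (hF 0 _))

/-- The errors are measurable functions of the array `u`. -/
theorem exists_err_eq_comp (hM : M.Assumptions μ) (ν : Fin d) (t : ℕ) :
    ∃ Φ : (Fin (L + 1) × ℤ → Fin d → ℝ) → ℝ, Measurable Φ ∧
      ∀ ω, M.err μ ν t ω = Φ fun i => M.u i.1 i.2 ω := by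
  refine ⟨fun v => M.H (Matrix.of (M.windowOf (fun ℓ τ => ∑' j : ℕ, (M.coef ℓ j).mulVec
    ((M.SigRoot ℓ (τ - j)).mulVec (v (ℓ, τ - j)))) t)) ν - ∫ ω', M.signal ν t ω' ∂μ, ?_,
    fun ω => rfl⟩
  refine (hM.measurable_H_windowOf (F := fun ℓ τ (v : Fin (L + 1) × ℤ → Fin d → ℝ) =>
    ∑' j : ℕ, (M.coef ℓ j).mulVec ((M.SigRoot ℓ (τ - j)).mulVec (v (ℓ, τ - j))))
    (fun ℓ τ => Measurable.tsum fun j => ?_) ν t).sub_const _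
  exact (Continuous.matrix_mulVec continuous_const
    (Continuous.matrix_mulVec continuous_const (continuous_apply _))).measurable

theorem measurable_u_array (hM : M.Assumptions μ) : Measurable fun ω (i : Fin (L + 1) × ℤ) => M.u i.1 i.2 ω :=
  measurable_pi_lambda _ fun i => hM.u_measurable i.1 i.2

theorem measurable_err (hM : M.Assumptions μ) (ν : Fin d) (t : ℕ) : Measurable (M.err μ ν t) := by
  obtain ⟨Φ, hΦ, h⟩ := hM.exists_err_eq_comp ν t
  rw [funext h]
  exact hΦ.comp hM.measurable_u_array

theorem measurable_linProc (hM : M.Assumptions μ) (ℓ : Fin (L + 1)) (t : ℤ) : Measurable (M.linProc ℓ t) :=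
  Measurable.tsum fun _ => (Continuous.matrix_mulVec continuous_const continuous_id).measurable.comp
    (hM.measurable_innov _ _)

theorem measurable_truncLinProc (hM : M.Assumptions μ) (K : ℕ) (ℓ : Fin (L + 1)) (t : ℤ) :
    Measurable (M.truncLinProc K ℓ t) :=
  Finset.measurable_sum _ fun _ _ =>
    (Continuous.matrix_mulVec continuous_const continuous_id).measurable.comp
      (hM.measurable_innov _ _)

theorem measurable_signal (hM : M.Assumptions μ) (ν : Fin d) (t : ℕ) : Measurable (M.signal ν t) :=
  hM.measurable_H_windowOf (F := M.linProc) hM.measurable_linProc ν t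

theorem measurable_truncSignal (hM : M.Assumptions μ) (ν : Fin d) (K t : ℕ) : Measurable (M.truncSignal ν K t) :=
  hM.measurable_H_windowOf (F := M.truncLinProc K) (hM.measurable_truncLinProc K) ν t

/-- The truncated signal at time `t` depends on the innovations at times `t - m - K < τ ≤ t` only. -/
theorem exists_truncSignal_eq_comp (hM : M.Assumptions μ) (ν : Fin d) (K t : ℕ) (S : Finset (Fin (L + 1) × ℤ))
    (hS : ∀ ℓ, ∀ k ≤ m, ∀ j < K, (ℓ, (t : ℤ) - (k : ℤ) - (j : ℤ)) ∈ S) :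
    ∃ Φ : (S → Fin d → ℝ) → ℝ, Measurable Φ ∧
      ∀ ω, M.truncSignal ν K t ω = Φ fun i => M.innov i.1.1 i.1.2 ω := by
  classical
  -- The default `0` outside `S` is never reached for the lags that occur, by `hS`.
  refine ⟨fun v => M.H (Matrix.of (M.windowOf (fun ℓ τ => ∑ j ∈ Finset.range K,
    (M.coef ℓ j).mulVec (if h : (ℓ, τ - (j : ℤ)) ∈ S then v ⟨_, h⟩ else 0)) t)) ν, ?_, fun ω => ?_⟩
  · refine hM.measurable_H_windowOf (F := fun ℓ τ (v : S → Fin d → ℝ) => ∑ j ∈ Finset.range K,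
      (M.coef ℓ j).mulVec (if h : (ℓ, τ - (j : ℤ)) ∈ S then v ⟨_, h⟩ else 0))
      (fun ℓ τ => Finset.measurable_sum _ fun j _ => ?_) ν t
    have hv : Measurable fun v : S → Fin d → ℝ =>
        if h : (ℓ, τ - (j : ℤ)) ∈ S then v ⟨_, h⟩ else 0 := by
      by_cases h : (ℓ, τ - (j : ℤ)) ∈ S
      · simp only [h, dite_true]
        exact measurable_pi_apply _
      · simp only [h, dite_false]
        exact measurable_const
    exact (Continuous.matrix_mulVec continuous_const continuous_id).measurable.comp hv
  · rw [truncSignal]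
    congr 2
    ext i k
    have h : ∀ ℓ, M.truncLinProc K ℓ ((t : ℤ) - ((k : ℕ) : ℤ)) ω = ∑ j ∈ Finset.range K,
        (M.coef ℓ j).mulVec (if (ℓ, (t : ℤ) - ((k : ℕ) : ℤ) - (j : ℤ)) ∈ S then
          M.innov ℓ ((t : ℤ) - ((k : ℕ) : ℤ) - (j : ℤ)) ω else 0) := fun ℓ => by
      refine Finset.sum_congr rfl fun j hj => ?_
      rw [if_pos (hS ℓ k (Nat.lt_succ_iff.1 k.2) j (Finset.mem_range.1 hj))]
    simp only [windowOf, h, dite_eq_ite]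

variable [IsProbabilityMeasure μ]

/-- Fourth moments control second ones through `x² ≤ 1 + x⁴`. -/
theorem exists_eLpNorm_innov_le (hM : M.Assumptions μ) : ∃ A : ℝ, 0 ≤ A ∧ ∀ ℓ t ν,
    eLpNorm (fun ω => M.innov ℓ t ω ν) 2 μ ≤ ENNReal.ofReal A := by
  obtain ⟨K, hK⟩ := hM.innov_moment
  refine ⟨√(1 + |K|), Real.sqrt_nonneg _, fun ℓ t ν => ?_⟩
  obtain ⟨hint, hle⟩ := hK ℓ t ν
  have hmeas : Measurable fun ω => M.innov ℓ t ω ν :=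
    (measurable_pi_apply ν).comp (hM.measurable_innov ℓ t)
  have hpt : ∀ ω, M.innov ℓ t ω ν ^ 2 ≤ 1 + |M.innov ℓ t ω ν| ^ 4 := fun ω => by
    rw [← sq_abs]
    nlinarith [sq_nonneg (|M.innov ℓ t ω ν| ^ 2 - 1), sq_nonneg (|M.innov ℓ t ω ν|)]
  have hint1 : Integrable (fun ω => 1 + |M.innov ℓ t ω ν| ^ 4) μ := (integrable_const 1).add hint
  have hsq : Integrable (fun ω => M.innov ℓ t ω ν ^ 2) μ :=
    hint1.mono' (hmeas.pow_const 2).aestronglyMeasurable (ae_of_all _ fun ω => by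
      rw [Real.norm_of_nonneg (sq_nonneg _)]; exact hpt ω)
  have hL2 : MemLp (fun ω => M.innov ℓ t ω ν) 2 μ :=
    (memLp_two_iff_integrable_sq hmeas.aestronglyMeasurable).2 hsq
  rw [hL2.eLpNorm_eq_integral_rpow_norm (by norm_num) (by norm_num)]
  refine ENNReal.ofReal_le_ofReal ?_
  rw [Real.sqrt_eq_rpow]
  simp only [ENNReal.toReal_ofNat, one_div]
  refine Real.rpow_le_rpow (integral_nonneg fun _ => by positivity) ?_ (by norm_num)
  simp only [Real.rpow_two, Real.norm_eq_abs, sq_abs]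
  refine (integral_mono hsq hint1 hpt).trans ?_
  rw [integral_add (integrable_const 1) hint]
  simp only [integral_const, probReal_univ, smul_eq_mul, mul_one]
  linarith [le_abs_self K]

/-- The truncation error of the linear processes is of the order `K⁻²` in `L²`. -/
theorem exists_eLpNorm_linProc_sub_le (hM : M.Assumptions μ) : ∃ c : ℝ, 0 ≤ c ∧ ∀ ℓ t ν (K : ℕ),
    eLpNorm (fun ω => M.linProc ℓ t ω ν - M.truncLinProc K ℓ t ω ν) 2 μ ≤
      ENNReal.ofReal (c * (((K : ℝ) + 1) ^ 2)⁻¹) := by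
  obtain ⟨A, hA, hinnov⟩ := hM.exists_eLpNorm_innov_le
  obtain ⟨D, δ', hδ', hdecay⟩ := hM.decay
  -- Only decay of order `4` is used. The factor `16 = 2⁴` comes from `j + 1 ≤ 2 max(j, 1)`.
  have hcoef : ∀ ℓ (j : ℕ) i k, |M.coef ℓ j i k| ≤ |D| * 16 * ((j : ℝ) + 1)⁻¹ ^ 4 :=
    fun ℓ j i k => by
    have h1 : (1 : ℝ) ≤ ((max j 1 : ℕ) : ℝ) := by exact_mod_cast le_max_right j 1
    have h2 : (j : ℝ) + 1 ≤ 2 * ((max j 1 : ℕ) : ℝ) := by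
      have := le_max_left j 1
      have := le_max_right j 1
      exact_mod_cast (by lia : j + 1 ≤ 2 * max j 1)
    have h3 : ((max j 1 : ℕ) : ℝ)⁻¹ ≤ 2 * ((j : ℝ) + 1)⁻¹ := by
      rw [← div_eq_mul_inv, le_div_iff₀ (by positivity), inv_mul_le_iff₀ (by positivity)]
      linarith
    calc |M.coef ℓ j i k| ≤ D * ((max j 1 : ℕ) : ℝ) ^ (-5 - δ') := hdecay ℓ j i k
      _ ≤ |D| * ((max j 1 : ℕ) : ℝ) ^ (-(4 : ℕ) : ℝ) := by
          refine mul_le_mul (le_abs_self D) (Real.rpow_le_rpow_of_exponent_le h1 ?_)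
            (by positivity) (abs_nonneg _)
          push_cast
          linarith
      _ = |D| * ((max j 1 : ℕ) : ℝ)⁻¹ ^ 4 := by
          rw [Real.rpow_neg (by positivity), Real.rpow_natCast, inv_pow]
      _ ≤ |D| * (2 * ((j : ℝ) + 1)⁻¹) ^ 4 := by gcongr
      _ = |D| * 16 * ((j : ℝ) + 1)⁻¹ ^ 4 := by ring
  set c : ℝ := d * (|D| * 16 * A) with hc
  have hc0 : 0 ≤ c := by positivity
  have hmeas : ∀ ℓ t k, Measurable fun ω => M.innov ℓ t ω k := fun ℓ t k =>
    (measurable_pi_apply k).comp (hM.measurable_innov ℓ t)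
  have hterm : ∀ ℓ (t : ℤ) i (j : ℕ),
      AEStronglyMeasurable (fun ω => (M.coef ℓ j).mulVec (M.innov ℓ (t - j) ω) i) μ ∧
      eLpNorm (fun ω => (M.coef ℓ j).mulVec (M.innov ℓ (t - j) ω) i) 2 μ ≤
        ENNReal.ofReal (c * ((j : ℝ) + 1)⁻¹ ^ 4) := fun ℓ t i j => by
    have heq : (fun ω => (M.coef ℓ j).mulVec (M.innov ℓ (t - j) ω) i) =
        ∑ k, fun ω => M.coef ℓ j i k * M.innov ℓ (t - j) ω k := by
      ext ω
      simp [Matrix.mulVec, dotProduct]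
    have hm : ∀ k ∈ Finset.univ, AEStronglyMeasurable
        (fun ω => M.coef ℓ j i k * M.innov ℓ (t - j) ω k) μ := fun k _ =>
      ((hmeas ℓ (t - j) k).const_mul _).aestronglyMeasurable
    rw [heq]
    refine ⟨Finset.aestronglyMeasurable_sum _ hm, (eLpNorm_sum_le hm (by norm_num)).trans ?_⟩
    calc ∑ k, eLpNorm (fun ω => M.coef ℓ j i k * M.innov ℓ (t - j) ω k) 2 μ
        ≤ ∑ _k : Fin d, ENNReal.ofReal (|D| * 16 * ((j : ℝ) + 1)⁻¹ ^ 4 * A) := by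
          refine Finset.sum_le_sum fun k _ => ?_
          have : (fun ω => M.coef ℓ j i k * M.innov ℓ (t - j) ω k) =
            M.coef ℓ j i k • fun ω => M.innov ℓ (t - j) ω k := rfl
          rw [this, eLpNorm_const_smul, ENNReal.ofReal_mul (by positivity)]
          refine mul_le_mul' ?_ (hinnov ℓ _ k)
          rw [← ofReal_norm]
          exact ENNReal.ofReal_le_ofReal (hcoef ℓ j i k)
      _ = ENNReal.ofReal (c * ((j : ℝ) + 1)⁻¹ ^ 4) := by
          rw [← ENNReal.ofReal_sum_of_nonneg fun _ _ => by positivity]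
          simp only [Finset.sum_const, Finset.card_univ, Fintype.card_fin, nsmul_eq_mul, hc]
          congr 1
          ring
  refine ⟨c * invSqSum, mul_nonneg hc0 invSqSum_nonneg, fun ℓ t i K => ?_⟩
  have hser := fun i => ae_summable_and_eLpNorm_tsum_sub_le (fun j => (hterm ℓ t i j).1) hc0
    (fun j => (hterm ℓ t i j).2)
  -- Coordinates of the vector series are series of coordinates only where all of these converge,
  -- hence almost everywhere.
  refine (eLpNorm_congr_ae ?_).trans_le ((hser i).2 K)
  filter_upwards [ae_all_iff.2 fun i => (hser i).1] with ω hω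
  rw [linProc, truncLinProc, tsum_apply (Pi.summable.2 hω), Finset.sum_apply]

/-- The truncation error of the signal is of the order `K⁻²` in `L²`. -/
theorem exists_eLpNorm_signal_sub_le (hM : M.Assumptions μ) : ∃ c : ℝ, 0 ≤ c ∧ ∀ ν t (K : ℕ),
    eLpNorm (fun ω => M.signal ν t ω - M.truncSignal ν K t ω) 2 μ ≤
      ENNReal.ofReal (c * (((K : ℝ) + 1) ^ 2)⁻¹) := by
  obtain ⟨c₁, hc₁, hlin⟩ := hM.exists_eLpNorm_linProc_sub_le
  obtain ⟨c₂, hc₂, hH⟩ := hM.exists_abs_H_windowOf_sub_le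
  refine ⟨d * ((m + 1 : ℕ) * ((L + 1 : ℕ) * (c₂ * c₁))), by positivity, fun ν t K => ?_⟩
  set Δ : Fin d × Fin (m + 1) × Fin (L + 1) → Ω → ℝ := fun x ω =>
    c₂ * |M.linProc x.2.2 ((t : ℤ) - ((x.2.1 : ℕ) : ℤ)) ω x.1 -
      M.truncLinProc K x.2.2 ((t : ℤ) - ((x.2.1 : ℕ) : ℤ)) ω x.1| with hΔ
  have hm : ∀ x ∈ Finset.univ, AEStronglyMeasurable (Δ x) μ := fun x _ =>
    ((((measurable_pi_apply x.1).comp (hM.measurable_linProc _ _)).sub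
      ((measurable_pi_apply x.1).comp (hM.measurable_truncLinProc K _ _))).abs.const_mul
        c₂).aestronglyMeasurable
  have hmono : eLpNorm (fun ω => M.signal ν t ω - M.truncSignal ν K t ω) 2 μ ≤
      eLpNorm (∑ x, Δ x) 2 μ := by
    refine eLpNorm_mono_real fun ω => ?_
    rw [Finset.sum_apply, Fintype.sum_prod_type]
    simp only [Fintype.sum_prod_type]
    exact hH ν _ _ t
  refine hmono.trans ((eLpNorm_sum_le hm (by norm_num)).trans ?_)
  calc ∑ x, eLpNorm (Δ x) 2 μ
      ≤ ∑ _x : Fin d × Fin (m + 1) × Fin (L + 1),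
          ENNReal.ofReal (c₂ * (c₁ * (((K : ℝ) + 1) ^ 2)⁻¹)) := by
        refine Finset.sum_le_sum fun x _ => ?_
        have : Δ x = c₂ • fun ω => ‖M.linProc x.2.2 ((t : ℤ) - ((x.2.1 : ℕ) : ℤ)) ω x.1 -
          M.truncLinProc K x.2.2 ((t : ℤ) - ((x.2.1 : ℕ) : ℤ)) ω x.1‖ := rfl
        rw [this, eLpNorm_const_smul, eLpNorm_norm, ENNReal.ofReal_mul hc₂,
          Real.enorm_of_nonneg hc₂]
        exact mul_le_mul' le_rfl (hlin _ _ _ K)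
    _ = _ := by
        rw [← ENNReal.ofReal_sum_of_nonneg fun _ _ => by positivity]
        simp only [Finset.sum_const, Finset.card_univ, Fintype.card_prod, Fintype.card_fin,
          nsmul_eq_mul]
        congr 1
        push_cast
        ring

end Assumptions

end ErrorModel

/-! ### Decay of autocovariances and growth of weighted sums. -/

namespace ErrorModel.Assumptions

variable {Ω : Type*} {d q m L : ℕ} {M : ErrorModel Ω d q m L} [MeasurableSpace Ω] {μ : Measure Ω}
  [IsProbabilityMeasure μ]

theorem memLp_signal_sub (hM : M.Assumptions μ) (ν : Fin d) (t K : ℕ) :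
    MemLp (fun ω => M.signal ν t ω - M.truncSignal ν K t ω) 2 μ := by
  obtain ⟨c, -, h⟩ := hM.exists_eLpNorm_signal_sub_le
  exact ⟨((hM.measurable_signal ν t).sub (hM.measurable_truncSignal ν K t)).aestronglyMeasurable,
    (h ν t K).trans_lt ENNReal.ofReal_lt_top⟩

theorem memLp_signal (hM : M.Assumptions μ) (ν : Fin d) (t : ℕ) : MemLp (M.signal ν t) 2 μ := by
  have h := (hM.memLp_signal_sub ν t 0).add (memLp_const (M.H (Matrix.of fun _ _ => 0) ν))
  rw [M.truncSignal_zero] at h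
  convert h using 1
  ext ω
  simp

theorem memLp_truncSignal (hM : M.Assumptions μ) (ν : Fin d) (K t : ℕ) : MemLp (M.truncSignal ν K t) 2 μ := by
  have h := (hM.memLp_signal ν t).sub (hM.memLp_signal_sub ν t K)
  convert h using 1
  ext ω
  simp

theorem memLp_err (hM : M.Assumptions μ) (ν : Fin d) (t : ℕ) : MemLp (M.err μ ν t) 2 μ :=
  (hM.memLp_signal ν t).sub (memLp_const _)

theorem exists_eLpNorm_signal_le (hM : M.Assumptions μ) (ν : Fin d) : ∃ G : ℝ, 0 ≤ G ∧ ∀ t,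
    eLpNorm (M.signal ν t) 2 μ ≤ ENNReal.ofReal G := by
  obtain ⟨c, hc, h⟩ := hM.exists_eLpNorm_signal_sub_le
  refine ⟨c + |M.H (Matrix.of fun _ _ => 0) ν|, by positivity, fun t => ?_⟩
  have heq : M.signal ν t = (fun ω => M.signal ν t ω - M.truncSignal ν 0 t ω) +
      fun _ => M.H (Matrix.of fun _ _ => 0) ν := by
    rw [M.truncSignal_zero]
    ext ω
    simp
  rw [heq, ENNReal.ofReal_add hc (abs_nonneg _)]
  refine (eLpNorm_add_le (hM.memLp_signal_sub ν t 0).1 aestronglyMeasurable_const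
    (by norm_num)).trans (add_le_add ?_ ?_)
  · simpa using h ν t 0
  · rw [eLpNorm_const _ (by norm_num) (NeZero.ne μ)]
    simp [← ofReal_norm]

/-- Truncated signals that involve disjoint time intervals are uncorrelated. -/
theorem covariance_truncSignal_eq_zero (hM : M.Assumptions μ) (ν : Fin d) {s t K : ℕ} (R : ℕ) (hst : s + m + K ≤ t) :
    cov[M.truncSignal ν R s, M.truncSignal ν K t; μ] = 0 := by
  obtain ⟨Φ, hΦ, hs⟩ := hM.exists_truncSignal_eq_comp ν R s
    (Finset.univ ×ˢ Finset.Icc ((s : ℤ) - m - R) s) (fun ℓ k hk j hj => by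
      simp only [Finset.mem_product, Finset.mem_univ, Finset.mem_Icc, true_and]
      lia)
  -- The oldest innovation used has time `t - m - (K - 1) ≥ s + 1`, strictly after `s`.
  obtain ⟨Ψ, hΨ, ht⟩ := hM.exists_truncSignal_eq_comp ν K t
    (Finset.univ ×ˢ Finset.Icc ((s : ℤ) + 1) t) (fun ℓ k hk j hj => by
      simp only [Finset.mem_product, Finset.mem_univ, Finset.mem_Icc, true_and]
      lia)
  have hdisj : Disjoint ((Finset.univ : Finset (Fin (L + 1))) ×ˢ Finset.Icc ((s : ℤ) - m - R) s)
      (Finset.univ ×ˢ Finset.Icc ((s : ℤ) + 1) t) := by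
    rw [Finset.disjoint_left]
    rintro ⟨ℓ, τ⟩ h1 h2
    simp only [Finset.mem_product, Finset.mem_univ, Finset.mem_Icc, true_and] at h1 h2
    lia
  have hind := (hM.innov_indep.indepFun_finset _ _ hdisj
    fun i => hM.measurable_innov i.1 i.2).comp hΦ hΨ
  refine IndepFun.covariance_eq_zero ?_ (hM.memLp_truncSignal ν R s) (hM.memLp_truncSignal ν K t)
  rw [funext hs, funext ht]
  exact hind

/-- A signal is uncorrelated with a later signal that is truncated before the lag of the former. -/
theorem covariance_signal_truncSignal_eq_zero (hM : M.Assumptions μ) (ν : Fin d) {s t K : ℕ} (hst : s + m + K ≤ t) :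
    cov[M.signal ν s, M.truncSignal ν K t; μ] = 0 := by
  obtain ⟨c, hc, h⟩ := hM.exists_eLpNorm_signal_sub_le
  set A := (eLpNorm (M.truncSignal ν K t) 2 μ).toReal with hA
  have hAle : eLpNorm (M.truncSignal ν K t) 2 μ ≤ ENNReal.ofReal A := by
    rw [hA, ENNReal.ofReal_toReal (hM.memLp_truncSignal ν K t).2.ne]
  -- The earlier signal involves infinitely many innovations. It is replaced by its truncation after
  -- `R` lags, with an error that vanishes as `R → ∞`.
  have hbound : ∀ R : ℕ, |cov[M.signal ν s, M.truncSignal ν K t; μ]| ≤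
      2 * (c * (((R : ℝ) + 1) ^ 2)⁻¹ * A) := fun R => by
    have hsplit := covariance_fun_sub_left (hM.memLp_signal ν s) (hM.memLp_truncSignal ν R s)
      (hM.memLp_truncSignal ν K t)
    rw [hM.covariance_truncSignal_eq_zero ν R hst, sub_zero] at hsplit
    rw [← hsplit]
    exact abs_covariance_le_of_eLpNorm_le (hM.memLp_signal_sub ν s R) (hM.memLp_truncSignal ν K t)
      (by positivity) ENNReal.toReal_nonneg (h ν s R) hAle
  have hlim : Tendsto (fun R : ℕ => 2 * (c * (((R : ℝ) + 1) ^ 2)⁻¹ * A)) atTop (𝓝 0) := by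
    simpa using ((summable_inv_succ_sq.tendsto_atTop_zero.const_mul c).mul_const A).const_mul 2
  exact abs_nonpos_iff.1 (ge_of_tendsto' hlim hbound)

/-- The autocovariances of the errors at lag `k` are of the order `k⁻²`. -/
theorem exists_abs_integral_err_mul_err_le (hM : M.Assumptions μ) (ν : Fin d) : ∃ c : ℝ, 0 ≤ c ∧ ∀ s t : ℕ, s ≤ t →
    |∫ ω, M.err μ ν s ω * M.err μ ν t ω ∂μ| ≤ c * (((t - s - m : ℕ) : ℝ) + 1 : ℝ)⁻¹ ^ 2 := by
  obtain ⟨c, hc, h⟩ := hM.exists_eLpNorm_signal_sub_le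
  obtain ⟨G, hG, hsig⟩ := hM.exists_eLpNorm_signal_le ν
  refine ⟨2 * (G * c), by positivity, fun s t hst => ?_⟩
  -- This is the longest truncation that avoids the past of `s`. If `t - s ≤ m` it is `0`, and the
  -- truncated signal is constant.
  set K := t - s - m with hK
  change |cov[M.signal ν s, M.signal ν t; μ]| ≤ _
  have hzero : cov[M.signal ν s, M.truncSignal ν K t; μ] = 0 := by
    rcases Nat.eq_zero_or_pos K with h0 | h0
    · rw [h0, M.truncSignal_zero, covariance_const_right]
    · exact hM.covariance_signal_truncSignal_eq_zero ν (by lia)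
  have hsplit := covariance_fun_sub_right (hM.memLp_signal ν s) (hM.memLp_signal ν t)
    (hM.memLp_truncSignal ν K t)
  rw [hzero, sub_zero] at hsplit
  rw [← hsplit]
  refine (abs_covariance_le_of_eLpNorm_le (hM.memLp_signal ν s) (hM.memLp_signal_sub ν t K) hG
    (by positivity) (hsig s) (h ν t K)).trans_eq ?_
  rw [inv_pow]
  ring

/-- The autocovariances of the errors are absolutely summable, uniformly in time. -/
theorem exists_sum_abs_integral_err_mul_err_le (hM : M.Assumptions μ) (ν : Fin d) : ∃ Q : ℝ, ∀ (s : ℕ) (I : Finset ℕ),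
    ∑ t ∈ I, |∫ ω, M.err μ ν s ω * M.err μ ν t ω ∂μ| ≤ Q := by
  obtain ⟨c, hc, h⟩ := hM.exists_abs_integral_err_mul_err_le ν
  set ρ : ℕ → ℝ := fun k => c * (((k - m : ℕ) : ℝ) + 1)⁻¹ ^ 2 with hρ
  have hρs : Summable ρ := by
    rw [← summable_nat_add_iff m]
    simpa [hρ] using summable_inv_succ_sq.mul_left c
  -- Times before and after `s` both occur, so the majorant is summed over all integer lags,
  -- independently of `s`.
  have hσ : Summable fun x : ℤ => ρ x.natAbs :=
    Summable.of_nat_of_neg (by simpa using hρs) (by simpa using hρs)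
  refine ⟨∑' x : ℤ, ρ x.natAbs, fun s I => ?_⟩
  have hinj : Function.Injective fun t : ℕ => (t : ℤ) - s := fun x y hxy => by
    simpa using hxy
  calc ∑ t ∈ I, |∫ ω, M.err μ ν s ω * M.err μ ν t ω ∂μ|
      ≤ ∑ t ∈ I, ρ ((t : ℤ) - s).natAbs := by
        refine Finset.sum_le_sum fun t _ => ?_
        rcases le_total s t with hst | hst
        · rw [show ((t : ℤ) - s).natAbs = t - s by lia]
          exact h s t hst
        · rw [show ((t : ℤ) - s).natAbs = s - t by lia]
          simpa only [mul_comm] using h t s hst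
    _ = ∑ x ∈ I.map ⟨fun t : ℕ => (t : ℤ) - s, hinj⟩, ρ x.natAbs := by
        rw [Finset.sum_map]
        rfl
    _ ≤ ∑' x : ℤ, ρ x.natAbs := hσ.sum_le_tsum _ fun _ _ => by positivity

/-- Growth of second moments of weighted sums of the errors, for bounded weights that are
independent of the innovations. -/
theorem exists_integral_sum_mul_err_sq_le (hM : M.Assumptions μ) (ν : Fin d) (B : ℝ) : ∃ Q : ℝ, ∀ x : ℕ → Ω → ℝ,
    (∀ t, Measurable (x t)) → (∀ t ≥ 1, ∀ᵐ ω ∂μ, |x t ω| ≤ B) →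
    IndepFun (fun ω (t : ℕ) => x (t + 1) ω) (fun ω (i : Fin (L + 1) × ℤ) => M.u i.1 i.2 ω) μ →
    ∀ N : ℕ, Integrable (fun ω => (∑ t ∈ Finset.Icc 1 N, x t ω * M.err μ ν t ω) ^ 2) μ ∧
      ∫ ω, (∑ t ∈ Finset.Icc 1 N, x t ω * M.err μ ν t ω) ^ 2 ∂μ ≤ Q * N := by
  obtain ⟨Q, hQ⟩ := hM.exists_sum_abs_integral_err_mul_err_le ν
  refine ⟨B * B * Q, fun x hx hB hind N => ?_⟩
  have hexp : (fun ω => (∑ t ∈ Finset.Icc 1 N, x t ω * M.err μ ν t ω) ^ 2) = fun ω =>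
      ∑ s ∈ Finset.Icc 1 N, ∑ t ∈ Finset.Icc 1 N,
        (x s ω * x t ω) * (M.err μ ν s ω * M.err μ ν t ω) := by
    ext ω
    rw [sq, Finset.sum_mul_sum]
    exact Finset.sum_congr rfl fun s _ => Finset.sum_congr rfl fun t _ => by ring
  have hxx : ∀ s ∈ Finset.Icc 1 N, ∀ t ∈ Finset.Icc 1 N, ∀ᵐ ω ∂μ, ‖x s ω * x t ω‖ ≤ B * B := by
    intro s hs t ht
    filter_upwards [hB s (Finset.mem_Icc.1 hs).1, hB t (Finset.mem_Icc.1 ht).1] with ω h1 h2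
    rw [Real.norm_eq_abs, abs_mul]
    exact mul_le_mul h1 h2 (abs_nonneg _) ((abs_nonneg _).trans h1)
  have hee : ∀ s t, Integrable (fun ω => M.err μ ν s ω * M.err μ ν t ω) μ := fun s t =>
    (hM.memLp_err ν s).integrable_mul (hM.memLp_err ν t)
  have hint : ∀ s ∈ Finset.Icc 1 N, ∀ t ∈ Finset.Icc 1 N,
      Integrable (fun ω => (x s ω * x t ω) * (M.err μ ν s ω * M.err μ ν t ω)) μ :=
    fun s hs t ht => (hee s t).bdd_mul ((hx s).mul (hx t)).aestronglyMeasurable (hxx s hs t ht)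
  have hterm : ∀ s ∈ Finset.Icc 1 N, ∀ t ∈ Finset.Icc 1 N,
      ∫ ω, (x s ω * x t ω) * (M.err μ ν s ω * M.err μ ν t ω) ∂μ ≤
        B * B * |∫ ω, M.err μ ν s ω * M.err μ ν t ω ∂μ| := by
    intro s hs t ht
    obtain ⟨Φ, hΦ, hs'⟩ := hM.exists_err_eq_comp ν s
    obtain ⟨Ψ, hΨ, ht'⟩ := hM.exists_err_eq_comp ν t
    -- Independence concerns the weights from time `1` on, indexed from `0`; hence the shifts `s -
    -- 1` and `t - 1`.
    have hprod : IndepFun (fun ω => x s ω * x t ω) (fun ω => M.err μ ν s ω * M.err μ ν t ω) μ := by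
      have hxm : Measurable fun v : ℕ → ℝ => v (s - 1) * v (t - 1) := by fun_prop
      have h := hind.comp (φ := fun v : ℕ → ℝ => v (s - 1) * v (t - 1))
        (ψ := fun v => Φ v * Ψ v) hxm (hΦ.mul hΨ)
      have h1 := Nat.sub_add_cancel (Finset.mem_Icc.1 hs).1
      have h2 := Nat.sub_add_cancel (Finset.mem_Icc.1 ht).1
      simp only [hs', ht']
      simpa only [Function.comp_def, h1, h2] using h
    rw [hprod.integral_fun_mul_eq_mul_integral ((hx s).mul (hx t)).aestronglyMeasurable
      (hee s t).1]
    refine (le_abs_self _).trans ?_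
    rw [abs_mul]
    refine mul_le_mul_of_nonneg_right ?_ (abs_nonneg _)
    have := norm_integral_le_of_norm_le_const (hxx s hs t ht)
    rwa [probReal_univ, mul_one, Real.norm_eq_abs] at this
  rw [hexp]
  refine ⟨integrable_finsetSum _ fun s hs => integrable_finsetSum _ fun t ht => hint s hs t ht, ?_⟩
  rw [integral_finsetSum _ fun s hs => integrable_finsetSum _ fun t ht => hint s hs t ht]
  calc ∑ s ∈ Finset.Icc 1 N, ∫ ω, ∑ t ∈ Finset.Icc 1 N,
        (x s ω * x t ω) * (M.err μ ν s ω * M.err μ ν t ω) ∂μ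
      ≤ ∑ s ∈ Finset.Icc 1 N, B * B * Q := by
        refine Finset.sum_le_sum fun s hs => ?_
        rw [integral_finsetSum _ fun t ht => hint s hs t ht]
        refine (Finset.sum_le_sum fun t ht => hterm s hs t ht).trans ?_
        rw [← Finset.mul_sum]
        exact mul_le_mul_of_nonneg_left (hQ s _) (mul_self_nonneg B)
    _ = B * B * Q * N := by
        rw [Finset.sum_const, Nat.card_Icc, nsmul_eq_mul, Nat.add_sub_cancel, mul_comm]

/-- The growth of sum moment assumption with `γ' = 2` holds for the error model, with a constant
that depends on the design only through the bound `B`. -/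
theorem exists_growthOfSumMoment (hM : M.Assumptions μ) (ν : Fin d) (B : ℝ) (T₀ : ℕ) (p : ℕ → ℕ) : ∃ Cν : ℝ,
    ∀ X : ℕ → ℕ → ℕ → Ω → ℝ, (∀ T t j, Measurable (X T t j)) →
      (∀ T ≥ T₀, ∀ t ≥ 1, ∀ j < p T, ∀ᵐ ω ∂μ, |X T t j ω| ≤ B) →
      (∀ T ≥ T₀, ∀ j < p T, IndepFun (fun ω (t : ℕ) => X T (t + 1) j ω)
        (fun ω (i : Fin (L + 1) × ℤ) => M.u i.1 i.2 ω) μ) →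
      GrowthOfSumMoment μ T₀ p X (M.err μ ν) 2 Cν := by
  obtain ⟨Q, hQ⟩ := hM.exists_integral_sum_mul_err_sq_le ν B
  refine ⟨Q, fun X hX hB hind γ h2 hγ T hT N j hj => ?_⟩
  obtain rfl : γ = 2 := le_antisymm hγ h2
  have h := hQ (fun t => X T t j) (fun t => hX T t j) (fun t ht => hB T hT t ht j hj)
    (hind T hT j hj) N
  simpa only [Real.rpow_two, sq_abs, div_self (two_ne_zero' ℝ), Real.rpow_one] using h

end ErrorModel.Assumptions

/-! ## Networks and the main theorem -/

theorem measurable_netOutput {Ω : Type*} [MeasurableSpace Ω] {g : ℕ → ℕ → ℝ → ℝ}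
    (hg : ∀ k j, Measurable (g k j)) (n : ℕ → ℕ) {W : ℕ → ℕ → ℕ → Ω → ℝ} {b : ℕ → ℕ → Ω → ℝ}
    {z : ℕ → Ω → ℝ} (hW : ∀ k j i, Measurable (W k j i)) (hb : ∀ k j, Measurable (b k j))
    (hz : ∀ i, Measurable (z i)) (k j : ℕ) :
    Measurable fun ω => netOutput g n (fun k j i => W k j i ω) (fun k j => b k j ω)
      (fun i => z i ω) k j := by
  induction k generalizing j with
  | zero => exact hz j
  | succ k ih =>
    exact (hg _ _).comp ((hb _ _).add (Finset.measurable_sum _ fun i _ => (hW _ _ _).mul (ih i)))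

/-- Almost every realization of a random design satisfies the regressor assumption. -/
theorem RegressorAssumption.ae_const {Ω : Type*} [MeasurableSpace Ω] {μ : Measure Ω} {T₀ : ℕ}
    {p : ℕ → ℕ} {X : ℕ → ℕ → ℕ → Ω → ℝ} {Sx : ∀ T, Matrix (Fin (p T)) (Fin (p T)) ℝ}
    {B η C a b : ℝ} (h : RegressorAssumption μ T₀ p X Sx B η C a b) :
    ∀ᵐ ω₀ ∂μ, RegressorAssumption μ T₀ p (fun T t j _ => X T t j ω₀) Sx B η C a b := by
  have h1 : ∀ᵐ ω ∂μ, ∀ T ≥ T₀, ∀ t ≥ 1, ∀ j < p T, |X T t j ω| ≤ B :=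
    ae_all_iff.2 fun T => ae_all_iff.2 fun hT => ae_all_iff.2 fun t => ae_all_iff.2 fun ht =>
      ae_all_iff.2 fun j => ae_all_iff.2 fun hj => h.bounded T hT t ht j hj
  have h2 : ∀ᵐ ω ∂μ, ∀ T ≥ T₀, ‖Matrix.toEuclideanCLM (𝕜 := ℝ) (gramMatrix p X T ω - Sx T)‖ ≤
      C * (p T : ℝ) ^ η / √(T : ℝ) :=
    ae_all_iff.2 fun T => ae_all_iff.2 fun hT => h.rate T hT
  have h3 : ∀ᵐ ω ∂μ, ∀ T ≥ T₀, spectrum ℝ (gramMatrix p X T ω) ⊆ Set.Icc a b :=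
    ae_all_iff.2 fun T => ae_all_iff.2 fun hT => h.spec T hT
  filter_upwards [h1, h2, h3] with ω₀ h1 h2 h3
  exact ⟨fun T hT t ht j hj => ae_of_all _ fun _ => h1 T hT t ht j hj, h.posDef, h.eta_nonneg,
    h.a_pos, h.a_le_b, fun T hT => ae_of_all _ fun _ => h2 T hT,
    fun T hT => ae_of_all _ fun _ => h3 T hT⟩

theorem mainTheorem1 {Ω : Type*} [MeasurableSpace Ω] (μ : Measure Ω) [IsProbabilityMeasure μ]
    (T₀ : ℕ) (hT₀ : 1 ≤ T₀) (p : ℕ → ℕ)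
    (X : ℕ → ℕ → ℕ → Ω → ℝ) (hX : ∀ T t j, Measurable (X T t j))
    (Sx : ∀ T, Matrix (Fin (p T)) (Fin (p T)) ℝ) (B η C a b : ℝ)
    (hreg : RegressorAssumption μ T₀ p X Sx B η C a b) :
    -- (i) consistency under the growth of sum moment assumption
    (RateCondition T₀ p η → ∀ γ' : ℝ, 2 ≤ γ' → ∃ K > (0 : ℝ), ∃ C' > (0 : ℝ),
      ∀ (e : ℕ → Ω → ℝ), (∀ t, AEMeasurable (e t) μ) → ∀ Cν : ℝ,
        GrowthOfSumMoment μ T₀ p X e γ' Cν →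
        ConsistencyAssertions μ T₀ p X η e γ' Cν K C') ∧
    -- (ii) the error model, with regressors independent of the errors (for example non-random)
    (∀ (d q m L : ℕ) (M : ErrorModel Ω d q m L), M.Assumptions μ →
      (∀ T, IndepFun (fun ω (i : ℕ × ℕ) => X T i.1 i.2 ω)
        (fun ω (i : Fin (L + 1) × ℤ) => M.u i.1 i.2 ω) μ) →
      ∀ ν : Fin d, ∃ Cν : ℝ,
        GrowthOfSumMoment μ T₀ p X (M.err μ ν) 2 Cν ∧
        (RateCondition T₀ p η → ∃ K > (0 : ℝ), ∃ C' > (0 : ℝ),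
          ConsistencyAssertions μ T₀ p X η (M.err μ ν) 2 Cν K C')) ∧
    -- (iii) features of a network with `r` hidden layers, random weights and random inputs: the
    -- assertions hold jointly, and conditionally on the weights and inputs (frozen features)
    (∀ (d q m L : ℕ) (M : ErrorModel Ω d q m L), M.Assumptions μ →
      ∀ (r : ℕ), 1 ≤ r → ∀ (g : ℕ → ℕ → ℝ → ℝ), (∀ k j, Measurable (g k j)) →
      ∀ (n : ℕ → ℕ → ℕ), (∀ T, n T r = p T) →
      ∀ (W : ℕ → ℕ → ℕ → ℕ → Ω → ℝ) (bias : ℕ → ℕ → ℕ → Ω → ℝ) (z : ℕ → ℕ → Ω → ℝ),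
      (∀ T k j i, Measurable (W T k j i)) → (∀ T k j, Measurable (bias T k j)) →
      (∀ t i, Measurable (z t i)) →
      (∀ T, IndepFun
        (fun ω => ((fun i : ℕ × ℕ × ℕ => W T i.1 i.2.1 i.2.2 ω),
          (fun i : ℕ × ℕ => bias T i.1 i.2 ω), (fun i : ℕ × ℕ => z i.1 i.2 ω)))
        (fun ω (i : Fin (L + 1) × ℤ) => M.u i.1 i.2 ω) μ) →
      (∀ T ≥ T₀, ∀ t ≥ 1, ∀ j < p T, ∀ ω, X T t j ω =
        netOutput g (n T) (fun k j i => W T k j i ω) (fun k j => bias T k j ω)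
          (fun i => z t i ω) r j) →
      ∀ ν : Fin d, ∃ Cν : ℝ,
        GrowthOfSumMoment μ T₀ p X (M.err μ ν) 2 Cν ∧
        (∀ᵐ ω₀ ∂μ, GrowthOfSumMoment μ T₀ p (fun T t j _ => X T t j ω₀) (M.err μ ν) 2 Cν) ∧
        (RateCondition T₀ p η → ∃ K > (0 : ℝ), ∃ C' > (0 : ℝ),
          ConsistencyAssertions μ T₀ p X η (M.err μ ν) 2 Cν K C' ∧
          ∀ᵐ ω₀ ∂μ, ConsistencyAssertions μ T₀ p (fun T t j _ => X T t j ω₀) η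
            (M.err μ ν) 2 Cν K C')) := by
  refine ⟨fun hrate γ' hγ' => ⟨max 1 a⁻¹ ^ γ', by positivity, 1, one_pos, fun e he Cν hG =>
    consistencyAssertions_of_growthOfSumMoment hT₀ hX hreg hrate hγ' he hG⟩, ?_, ?_⟩
  · intro d q m L M hM hind ν
    obtain ⟨Cν, hCν⟩ := hM.exists_growthOfSumMoment ν B T₀ p
    have hG := hCν X hX hreg.bounded fun T _ j _ =>
      (hind T).comp (φ := fun v (t : ℕ) => v (t + 1, j)) (ψ := id)
        (measurable_pi_lambda _ fun t => measurable_pi_apply _) measurable_id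
    exact ⟨Cν, hG, fun hrate => ⟨max 1 a⁻¹ ^ (2 : ℝ), by positivity, 1, one_pos,
      consistencyAssertions_of_growthOfSumMoment hT₀ hX hreg hrate le_rfl
        (fun t => (hM.measurable_err ν t).aemeasurable) hG⟩⟩
  · intro d q m L M hM r _ g hg n _ W bias z _ _ _ hind hnet ν
    obtain ⟨Cν, hCν⟩ := hM.exists_growthOfSumMoment ν B T₀ p
    have hG : GrowthOfSumMoment μ T₀ p X (M.err μ ν) 2 Cν := by
      refine hCν X hX hreg.bounded fun T hT j hj => ?_
      let φ : (ℕ × ℕ × ℕ → ℝ) × (ℕ × ℕ → ℝ) × (ℕ × ℕ → ℝ) → ℕ → ℝ := fun w t =>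
        netOutput g (n T) (fun k j i => w.1 (k, j, i)) (fun k j => w.2.1 (k, j))
          (fun i => w.2.2 (t + 1, i)) r j
      have hφ : Measurable φ := measurable_pi_lambda _ fun t => measurable_netOutput hg (n T)
        (fun k j i => (measurable_pi_apply (k, j, i)).comp measurable_fst)
        (fun k j => (measurable_pi_apply (k, j)).comp (measurable_fst.comp measurable_snd))
        (fun i => (measurable_pi_apply (t + 1, i)).comp (measurable_snd.comp measurable_snd)) r j
      have heq : (fun ω (t : ℕ) => X T (t + 1) j ω) = fun ω (t : ℕ) =>
          netOutput g (n T) (fun k j i => W T k j i ω) (fun k j => bias T k j ω)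
            (fun i => z (t + 1) i ω) r j := by
        ext ω t
        exact hnet T hT (t + 1) (Nat.le_add_left 1 t) j hj ω
      rw [heq]
      exact (hind T).comp hφ measurable_id
    -- A frozen design is constant in `ω`, hence independent of everything, and `Cν` was chosen
    -- before the design.
    have hG₀ : ∀ ω₀, RegressorAssumption μ T₀ p (fun T t j _ => X T t j ω₀) Sx B η C a b →
        GrowthOfSumMoment μ T₀ p (fun T t j _ => X T t j ω₀) (M.err μ ν) 2 Cν := fun ω₀ h =>
      hCν _ (fun _ _ _ => measurable_const) h.bounded fun _ _ _ _ => indepFun_const_left _ _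
    refine ⟨Cν, hG, hreg.ae_const.mono hG₀, fun hrate => ⟨max 1 a⁻¹ ^ (2 : ℝ), by positivity, 1,
      one_pos, consistencyAssertions_of_growthOfSumMoment hT₀ hX hreg hrate le_rfl
        (fun t => (hM.measurable_err ν t).aemeasurable) hG, hreg.ae_const.mono fun ω₀ h =>
      consistencyAssertions_of_growthOfSumMoment hT₀ (fun _ _ _ => measurable_const) h hrate le_rfl
        (fun t => (hM.measurable_err ν t).aemeasurable) (hG₀ ω₀ h)⟩⟩
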